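/- Let $c\ge 1$ be an integer, let $(b_j)_{j\ge 0}$ be real numbers with $b_j\ge 0$ for $j\ne 1$, $b_0>0$, $\sum_{j\ge 2}b_j>0$ and $-b_1=\sum_{j\ne 1}b_j<\infty$, and let $(h_j)_{j\ge 1}$ be nonnegative numbers with $0<h:=\sum_{j\ge 1}h_j<\infty$. The $M^X/M/c$ queue with resurrection is the continuous-time Markov chain on $\{0,1,2,\dots\}$ (the Feller minimal process) whose conservative $q$-matrix $\tilde Q=(\tilde q_{ij})$ is given by $$\tilde q_{00}=-h,\qquad \tilde q_{0j}=h_j\ (j\ge 1),$$ and, for $i\ge 1$, $$\tilde q_{i,i-1}=\min(i,c)\,b_0,\qquad \tilde q_{ii}=b_1-[\min(i,c)-1]\,b_0,\qquad \tilde q_{ij}=b_{j-i+1}\ (j\ge i+1),$$ all other entries being $0$; that is, $\tilde Q=Q^*+Q_s$, where $Q^*$ consists of the rows $i\ge 1$ and $Q_s$ of the row $i=0$. For $s\in[0,1]$ let $$B_c(s)=\sum_{j=0}^\infty b_js^j+(c-1)b_0(1-s),$$ let $B_c'(1)=\lim_{s\uparrow 1}\frac{B_c(s)-B_c(1)}{s-1}\in(-\infty,+\infty]$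 be its left derivative at $1$, and let $\mu_1=\sum_{j\ge 1}jh_j\in(0,\infty]$. The chain is called recurrent if from every state it returns to that state, after having left it, with probability one, and positive recurrent if the mean return time of every state is finite. Then: (i) the chain is recurrent if and only if $B_c'(1)\le 0$; (ii) the chain is positive recurrent if and only if $B_c'(1)<0$ and $\mu_1<\infty$. -/

import Mathlib

open MeasureTheory ProbabilityTheory Filter Topology
open scoped ENNReal NNReal

noncomputable section

/-- A conservative `q`-matrix on `{0,1,2,…}`: off-diagonal entries are nonnegative and every row
is summable with sum `0` (so that `∑_{j ≠ i} q_{ij} = -q_{ii} < ∞`). -/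
structure ConservativeQMatrix where
  rate : ℕ → ℕ → ℝ
  rate_nonneg : ∀ i j, i ≠ j → 0 ≤ rate i j
  hasSum_row : ∀ i, HasSum (rate i) 0

namespace ConservativeQMatrix

variable (Q : ConservativeQMatrix)

/-- Total rate `q_i = -q_{ii}` of leaving the state `i`. -/
def exitRate (i : ℕ) : ℝ := -Q.rate i i

/-- Jump probabilities: `q_{ij} / q_i` for `j ≠ i` if `q_i ≠ 0`; an absorbing state (`q_i = 0`)
is never left. -/
def jumpProb (i j : ℕ) : ℝ :=
  if Q.exitRate i = 0 then (if j = i then 1 else 0)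
  else if j = i then 0 else Q.rate i j / Q.exitRate i

theorem hasSum_offDiag (i : ℕ) :
    HasSum (fun j => if j = i then 0 else Q.rate i j) (Q.exitRate i) := by
  have h := (Q.hasSum_row i).update i 0
  simp only [zero_sub, add_zero] at h
  have e : Function.update (Q.rate i) i 0 = fun j => if j = i then 0 else Q.rate i j := by
    funext j
    simp [Function.update_apply]
  rw [e] at h
  exact h

theorem exitRate_nonneg (i : ℕ) : 0 ≤ Q.exitRate i :=
  (Q.hasSum_offDiag i).nonneg fun j => by
    split_ifs with h
    · exact le_rfl
    · exact Q.rate_nonneg i j fun e => h e.symm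

theorem jumpProb_nonneg (i j : ℕ) : 0 ≤ Q.jumpProb i j := by
  unfold jumpProb
  split_ifs with h1 h2 h2
  · exact zero_le_one
  · exact le_rfl
  · exact le_rfl
  · exact div_nonneg (Q.rate_nonneg i j fun e => h2 e.symm) (Q.exitRate_nonneg i)

theorem hasSum_jumpProb (i : ℕ) : HasSum (Q.jumpProb i) 1 := by
  by_cases h : Q.exitRate i = 0
  · have e : Q.jumpProb i = fun j => if j = i then 1 else 0 := by
      funext j
      simp [jumpProb, h]
    rw [e]
    exact hasSum_ite_eq i 1
  · have e : Q.jumpProb i = fun j => (if j = i then 0 else Q.rate i j) / Q.exitRate i := by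
      funext j
      by_cases hj : j = i <;> simp [jumpProb, h, hj]
    rw [e, ← div_self h]
    exact (Q.hasSum_offDiag i).div_const _

/-- The law of the next state visited from the state `i`. -/
def jumpPMF (i : ℕ) : PMF ℕ :=
  ⟨fun j => ENNReal.ofReal (Q.jumpProb i j), by
    rw [← ENNReal.ofReal_one]
    exact ENNReal.hasSum_coe.2
      ((Q.hasSum_jumpProb i).toNNReal (Q.jumpProb_nonneg i))⟩

/-- The transition kernel of the embedded jump chain. -/
def jumpKernel : Kernel ℕ ℕ := Kernel.ofFunOfCountable fun i => (Q.jumpPMF i).toMeasure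

instance : IsMarkovKernel Q.jumpKernel :=
  ⟨fun i => by
    change IsProbabilityMeasure (Q.jumpPMF i).toMeasure
    infer_instance⟩

/-- The one-step kernel of the jump chain as a function of its history up to time `n`:
only the present state matters. -/
def stepKernel (n : ℕ) : Kernel (Finset.Iic n → ℕ) ℕ :=
  Q.jumpKernel.comap (fun x => x ⟨n, Finset.mem_Iic.2 le_rfl⟩) (measurable_pi_apply _)

instance (n : ℕ) : IsMarkovKernel (Q.stepKernel n) := by
  unfold stepKernel
  infer_instance

/-- The law on `ℕ → ℕ` of the jump chain started from the state `i`. -/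
def jumpChainLaw (i : ℕ) : Measure (ℕ → ℕ) :=
  Kernel.trajMeasure (X := fun _ => ℕ) (Measure.dirac i) Q.stepKernel

/-- The sample space: a sequence of visited states together with a sequence of standard
exponential clocks. -/
abbrev Path : Type := (ℕ → ℕ) × (ℕ → ℝ)

/-- The law `P_i` of the Feller minimal `Q`-process started from `i`: the visited states form the
jump chain started from `i`, and the clocks are i.i.d. exponential variables of parameter `1`
independent of the jump chain. -/
def law (i : ℕ) : Measure Path :=
  (Q.jumpChainLaw i).prod (Measure.infinitePi fun _ => expMeasure 1)

/-- The holding time in the `n`-th visited state `Y_n`, exponential of parameter `q_{Y_n}` given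
the jump chain (infinite if `Y_n` is absorbing). -/
def holdingTime (n : ℕ) (ω : Path) : ℝ≥0∞ :=
  ENNReal.ofReal (ω.2 n) / ENNReal.ofReal (Q.exitRate (ω.1 n))

/-- The time `J_n` of the `n`-th jump, `J_0 = 0`. -/
def jumpTime (n : ℕ) (ω : Path) : ℝ≥0∞ := ∑ k ∈ Finset.range n, Q.holdingTime k ω

open Classical in
/-- The Feller minimal `Q`-process `X_t`: it is at the `n`-th visited state during
`[J_n, J_{n+1})`, and in a cemetery state `none` from the explosion time `lim J_n` on. -/
def process (t : ℝ≥0) (ω : Path) : Option ℕ :=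
  if h : ∃ n, Q.jumpTime n ω ≤ t ∧ (t : ℝ≥0∞) < Q.jumpTime (n + 1) ω
  then some (ω.1 (Nat.find h)) else none

/-- The return time to `i`: the first time at or after the first jump at which the process is at
`i`; it is `∞` if there is no such time. -/
def returnTime (i : ℕ) (ω : Path) : ℝ≥0∞ :=
  ⨅ (t : ℝ≥0) (_ : Q.jumpTime 1 ω ≤ t ∧ Q.process t ω = some i), (t : ℝ≥0∞)

/-- The `Q`-process is recurrent: every state is absorbing, or a return to it after leaving it has
probability one. -/
def IsRecurrent : Prop :=
  ∀ i, Q.exitRate i = 0 ∨ Q.law i {ω | Q.returnTime i ω < ∞} = 1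

/-- The `Q`-process is positive recurrent: every state is absorbing, or has a finite mean return
time. -/
def IsPositiveRecurrent : Prop :=
  ∀ i, Q.exitRate i = 0 ∨ ∫⁻ ω, Q.returnTime i ω ∂(Q.law i) < ∞

end ConservativeQMatrix

/-- The data of the `M^X/M/c` queue with resurrection (and without catastrophes). The sequence
`(h_j)_{j ≥ 1}` is extended by `h_0 = 0`. -/
structure BulkQueue where
  /-- the number of servers -/
  c : ℕ
  one_le_c : 1 ≤ c
  /-- the sequence `(b_j)_{j ≥ 0}` -/
  b : ℕ → ℝ
  /-- the sequence `(h_j)_{j ≥ 1}` of arrival rates at idle time -/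
  h : ℕ → ℝ
  b_nonneg : ∀ j, j ≠ 1 → 0 ≤ b j
  /-- `-b_1 = ∑_{j ≠ 1} b_j < ∞` -/
  hasSum_b : HasSum b 0
  b_zero_pos : 0 < b 0
  tsum_b_pos : 0 < ∑' j, b (j + 2)
  h_zero : h 0 = 0
  h_nonneg : ∀ j, 0 ≤ h j
  summable_h : Summable h
  tsum_h_pos : 0 < ∑' j, h j

namespace BulkQueue

variable (M : BulkQueue)

/-- The `q`-matrix `Q*` of the queue stopped when it becomes empty. -/
def rateStar (i j : ℕ) : ℝ :=
  if 1 ≤ i ∧ j + 1 = i then ((min i M.c : ℕ) : ℝ) * M.b 0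
  else if 1 ≤ i ∧ j = i then M.b 1 - (((min i M.c : ℕ) : ℝ) - 1) * M.b 0
  else if 1 ≤ i ∧ i + 1 ≤ j then M.b (j - i + 1)
  else 0

/-- The `q`-matrix `Q_s` of the resurrection. -/
def rateRes (i j : ℕ) : ℝ :=
  if i = 0 ∧ j = 0 then -∑' k, M.h k
  else if i = 0 ∧ 1 ≤ j then M.h j
  else 0

theorem rate_zero_hasSum : HasSum (fun j => M.rateStar 0 j + M.rateRes 0 j) 0 := by
  have hs := M.summable_h.hasSum.update 0 (-∑' k, M.h k)
  rw [M.h_zero] at hs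
  have e : Function.update M.h 0 (-∑' k, M.h k) = fun j => M.rateStar 0 j + M.rateRes 0 j := by
    funext j
    rcases Nat.eq_zero_or_pos j with rfl | hj
    · simp [rateStar, rateRes]
    · have h1 : 1 ≤ j := hj
      have h2 : j ≠ 0 := by omega
      simp [rateStar, rateRes, h1, h2]
  rw [e] at hs
  simpa using hs

theorem rate_succ_hasSum (i : ℕ) :
    HasSum (fun j => M.rateStar (i + 1) j + M.rateRes (i + 1) j) 0 := by
  set m : ℝ := ((min (i + 1) M.c : ℕ) : ℝ) with hm
  have h1 := (M.hasSum_b.update 0 (m * M.b 0)).update 1 (M.b 1 - (m - 1) * M.b 0)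
  have hz : (M.b 1 - (m - 1) * M.b 0) - Function.update M.b 0 (m * M.b 0) 1
      + (m * M.b 0 - M.b 0 + 0) = 0 := by
    rw [Function.update_of_ne (by norm_num)]
    ring
  rw [hz] at h1
  have hinj : Function.Injective fun k : ℕ => k + i := fun x y hxy => by
    simpa using hxy
  have h2 := (hinj.hasSum_iff
    (f := fun j => M.rateStar (i + 1) j + M.rateRes (i + 1) j) (a := 0) ?_).1 ?_
  · exact h2
  · intro j hj
    have hlt : j < i := by
      by_contra hcon
      exact hj ⟨j - i, by simp only; omega⟩
    have a2 : ¬ (j = i + 1) := by omega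
    have a3 : ¬ (i + 1 + 1 ≤ j) := by omega
    have a4 : ¬ (j = i) := by omega
    simp [rateStar, rateRes, a2, a3, a4]
  · refine (congrArg (fun f : ℕ → ℝ => HasSum f 0) (funext fun k => ?_)).mpr h1
    rcases k with _ | _ | k
    · simp [rateStar, rateRes, hm]
    · have a1 : ¬ (1 + i + 1 = i + 1) := by omega
      have a2 : 1 + i = i + 1 := by omega
      simp [rateStar, rateRes, hm, a2]
    · have a1 : ¬ (k + 1 + 1 + i = i) := by omega
      have a2 : ¬ (k + 1 + 1 + i = i + 1) := by omega
      have a4 : k + 1 + 1 + i - (i + 1) + 1 = k + 1 + 1 := by omega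
      have a5 : i + 1 < k + 1 + 1 + i := by omega
      simp [rateStar, rateRes, a2, a4, a5]

/-- The conservative `q`-matrix `Q* + Q_s`. -/
def qMatrix : ConservativeQMatrix where
  rate i j := M.rateStar i j + M.rateRes i j
  rate_nonneg i j hij := by
    have hb0 := M.b_zero_pos.le
    refine add_nonneg ?_ ?_
    · unfold rateStar
      split_ifs with h1 h2 h3
      · positivity
      · exact absurd h2.2.symm hij
      · exact M.b_nonneg _ (by omega)
      · exact le_rfl
    · unfold rateRes
      split_ifs with h1 h2
      · exact absurd (h1.1.trans h1.2.symm) hij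
      · exact M.h_nonneg j
      · exact le_rfl
  hasSum_row i := by
    rcases i with _ | i
    · exact M.rate_zero_hasSum
    · exact M.rate_succ_hasSum i

/-- The generating function `B(s) = ∑ b_j s^j`. -/
def genB (s : ℝ) : ℝ := ∑' j, M.b j * s ^ j

/-- The function `B_c(s) = B(s) + (c - 1) b_0 (1 - s)`. -/
def genBc (s : ℝ) : ℝ := M.genB s + ((M.c : ℝ) - 1) * M.b 0 * (1 - s)

/-- The derivative `B_c'(1)`, i.e. the left derivative of `B_c` at `1`, an extended real number
(it is `+∞` exactly if `∑ j b_j` diverges). -/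
def derivBcOne : EReal :=
  limUnder (𝓝[<] (1 : ℝ)) fun s => (((M.genBc s - M.genBc 1) / (s - 1) : ℝ) : EReal)

theorem summable_b_mul_pow {s : ℝ} (h0 : 0 ≤ s) (h1 : s ≤ 1) :
    Summable fun j => M.b j * s ^ j := by
  refine Summable.of_norm_bounded M.hasSum_b.summable.norm fun j => ?_
  rw [norm_mul, norm_pow, Real.norm_of_nonneg h0]
  exact mul_le_of_le_one_right (norm_nonneg _) (pow_le_one₀ h0 h1)

theorem slope_monotoneOn :
    MonotoneOn (fun s => (M.genBc s - M.genBc 1) / (s - 1)) (Set.Ioo 0 1) := by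
  have key : ∀ s ∈ Set.Ioo (0 : ℝ) 1,
      HasSum (fun j => M.b j * ∑ k ∈ Finset.range j, s ^ k)
        ((M.genBc s - M.genBc 1) / (s - 1) + ((M.c : ℝ) - 1) * M.b 0) := by
    intro s hs
    have hne : s - 1 ≠ 0 := by linarith [hs.2]
    have a := (M.summable_b_mul_pow hs.1.le hs.2.le).hasSum
    have b := (M.summable_b_mul_pow zero_le_one le_rfl).hasSum
    have d := (a.sub b).div_const (s - 1)
    have e1 : (fun j => M.b j * ∑ k ∈ Finset.range j, s ^ k)
        = fun j => (M.b j * s ^ j - M.b j * 1 ^ j) / (s - 1) := by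
      funext j
      rw [geom_sum_eq (by linarith [hs.2])]
      ring
    have e2 : (M.genBc s - M.genBc 1) / (s - 1) + ((M.c : ℝ) - 1) * M.b 0
        = ((∑' j, M.b j * s ^ j) - ∑' j, M.b j * 1 ^ j) / (s - 1) := by
      unfold genBc genB
      field_simp
      ring
    rw [e1, e2]
    exact d
  intro s hs t ht hst
  have := hasSum_le (fun j => ?_) (key s hs) (key t ht)
  · simpa using this
  · by_cases hj : j = 1
    · subst hj
      simp
    · have := hs.1.le
      exact mul_le_mul_of_nonneg_left
        (Finset.sum_le_sum fun k _ => pow_le_pow_left₀ hs.1.le hst k) (M.b_nonneg j hj)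

/-- The limit defining `B_c'(1)` exists in the extended real line. -/
theorem tendsto_derivBcOne :
    Tendsto (fun s : ℝ => (((M.genBc s - M.genBc 1) / (s - 1) : ℝ) : EReal)) (𝓝[<] (1 : ℝ))
      (𝓝 M.derivBcOne) := by
  have hmono : MonotoneOn (fun s : ℝ => (((M.genBc s - M.genBc 1) / (s - 1) : ℝ) : EReal))
      (Set.Ioo 0 1) := fun s hs t ht hst =>
    EReal.coe_le_coe_iff.2 (M.slope_monotoneOn hs ht hst)
  have := hmono.tendsto_nhdsWithin_Ioo_left (by norm_num) (OrderTop.bddAbove _)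
  exact tendsto_nhds_limUnder ⟨_, this⟩

/-- The mean `μ_1 = H'(1) = ∑ j h_j`, possibly infinite. -/
def muOne : ℝ≥0∞ := ∑' j : ℕ, (j : ℝ≥0∞) * ENNReal.ofReal (M.h j)

end BulkQueue

end

/-! The exit rates lie between two positive constants, so the mean return time is finite exactly
when the mean number of jumps before return is. Everything thus reduces to the jump chain and to
`survival`: recurrence means that `survival κ j n j` tends to zero for every `j`, positive
recurrence that its sum over `n` is finite.

From level `c` on all servers work, and the chain moves like a random walk with down-steps of size
one and drift `upDrift - c b_0 = B_c'(1)` per unit time. With `V x = x`, Foster's criteria give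
recurrence for drift `≤ 0`, and positive recurrence for drift `< 0` if one jump from each state
below `c` has finite mean, which at state `0` means `μ_1 < ∞`.

The converses use subharmonic functions vanishing up to `c - 1`. If `B_c'(1) > 0`, some `s < 1` has
`B_c(s) < 0`, and `1 - s ^ (x - (c - 1))` (truncated subtraction) bounds the escape probability from
below. If `B_c'(1) ≥ 0`, the function `x - (c - 1)` is subharmonic and at most the mean time to
reach `c - 1`, because descents are by single steps; this forces an infinite mean. If `μ_1 = ∞`, the
first jump from `0` lands at infinite mean height, and each level costs a jump on the way back. -/

/-! ### Taboo probabilities of a Markov kernel on `ℕ` -/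

namespace MarkovChain

variable (κ : Kernel ℕ ℕ)

/-- One step of the chain, killed on entering `j`. -/
noncomputable def tabooOp (j : ℕ) (f : ℕ → ℝ≥0∞) (x : ℕ) : ℝ≥0∞ := ∫⁻ y in {j}ᶜ, f y ∂κ x

/-- The probability that the chain started from `x` avoids `j` at the times `1, …, n`. -/
noncomputable def survival (j n : ℕ) : ℕ → ℝ≥0∞ := (tabooOp κ j)^[n] 1

/-- Every state can be reached from every state in at least one step. -/
def IsIrreducible : Prop := ∀ x y, Relation.TransGen (fun x y => κ x {y} ≠ 0) x y

variable {κ} {j : ℕ} {f g : ℕ → ℝ≥0∞}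

theorem tabooOp_mono (h : f ≤ g) : tabooOp κ j f ≤ tabooOp κ j g :=
  fun _ => lintegral_mono h

theorem tabooOp_le_lintegral (x : ℕ) : tabooOp κ j f x ≤ ∫⁻ y, f y ∂κ x :=
  setLIntegral_le_lintegral _ _

theorem tabooOp_eq_lintegral (hf : f j = 0) (x : ℕ) : tabooOp κ j f x = ∫⁻ y, f y ∂κ x := by
  unfold tabooOp
  rw [← lintegral_indicator (MeasurableSet.of_discrete)]
  refine lintegral_congr fun y => ?_
  by_cases hy : y = j
  · simp [hy, hf]
  · simp [hy]

theorem tabooOp_add (x : ℕ) :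
    tabooOp κ j (fun y => f y + g y) x = tabooOp κ j f x + tabooOp κ j g x :=
  lintegral_add_left Measurable.of_discrete _

theorem tabooOp_const_mul (a : ℝ≥0∞) (x : ℕ) :
    tabooOp κ j (fun y => a * f y) x = a * tabooOp κ j f x :=
  lintegral_const_mul _ Measurable.of_discrete

theorem tabooOp_finset_sum {F : ℕ → ℕ → ℝ≥0∞} (s : Finset ℕ) (x : ℕ) :
    tabooOp κ j (fun y => ∑ k ∈ s, F k y) x = ∑ k ∈ s, tabooOp κ j (F k) x :=
  lintegral_finsetSum _ fun _ _ => Measurable.of_discrete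

theorem tabooOp_tsum {F : ℕ → ℕ → ℝ≥0∞} (x : ℕ) :
    tabooOp κ j (fun y => ∑' k, F k y) x = ∑' k, tabooOp κ j (F k) x :=
  lintegral_tsum fun _ => Measurable.of_discrete.aemeasurable

@[simp] theorem survival_zero (x : ℕ) : survival κ j 0 x = 1 := rfl

theorem survival_succ (n : ℕ) : survival κ j (n + 1) = tabooOp κ j (survival κ j n) :=
  Function.iterate_succ_apply' _ _ _

section Markov

variable [IsMarkovKernel κ]

theorem survival_succ_le (n : ℕ) : survival κ j (n + 1) ≤ survival κ j n := by
  induction n with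
  | zero =>
    intro x
    rw [survival_succ]
    refine (tabooOp_le_lintegral x).trans ?_
    simp
  | succ n ih =>
    calc survival κ j (n + 2) = tabooOp κ j (survival κ j (n + 1)) := survival_succ _
      _ ≤ tabooOp κ j (survival κ j n) := tabooOp_mono ih
      _ = survival κ j (n + 1) := (survival_succ n).symm

theorem survival_antitone : Antitone (survival κ j) := antitone_nat_of_succ_le survival_succ_le

theorem survival_le_one (n x : ℕ) : survival κ j n x ≤ 1 := survival_antitone (Nat.zero_le n) x

/-- Decreasing limits pass through the integral since `survival` is at most one; the probability of
never visiting `j` is therefore harmonic for the killed chain. -/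
theorem tabooOp_iInf_survival (x : ℕ) :
    tabooOp κ j (fun y => ⨅ n, survival κ j n y) x = ⨅ n, survival κ j n x := by
  unfold tabooOp
  rw [lintegral_iInf (fun _ => Measurable.of_discrete) survival_antitone]
  · have : ∀ n, ∫⁻ y in {j}ᶜ, survival κ j n y ∂κ x = survival κ j (n + 1) x := fun n => by
      rw [survival_succ]
      rfl
    simp only [this]
    refine le_antisymm (le_iInf fun n => (iInf_le _ n).trans (survival_succ_le n x))
      (le_iInf fun n => iInf_le _ (n + 1))
  · refine ne_top_of_le_ne_top ENNReal.one_ne_top ?_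
    refine (setLIntegral_le_lintegral _ _).trans ?_
    simp

/-- The average of a function is larger than its minimum, unless all points of positive mass are
minimum points. -/
theorem lt_lintegral {a : ℝ≥0∞} (ha : a ≠ ∞) {x z : ℕ} (hf : ∀ y, a ≤ f y) (hz : κ x {z} ≠ 0)
    (haz : a < f z) : a < ∫⁻ y, f y ∂κ x := by
  have h1 : ∫⁻ y, (a + Set.indicator {z} (fun _ => f z - a) y) ∂κ x ≤ ∫⁻ y, f y ∂κ x := by
    refine lintegral_mono fun y => ?_
    by_cases hy : y = z
    · subst hy
      simp [add_tsub_cancel_of_le haz.le]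
    · simpa [hy] using hf y
  refine lt_of_lt_of_le ?_ h1
  rw [lintegral_add_left Measurable.of_discrete, lintegral_indicator_const MeasurableSet.of_discrete]
  simp only [lintegral_const, measure_univ, mul_one]
  exact ENNReal.lt_add_right ha (mul_ne_zero (tsub_pos_of_lt haz).ne' hz)

/-! ### Foster's criteria -/

/-- **Foster's criterion for recurrence** of a chain which can decrease from every high state. -/
theorem iInf_survival_eq_zero (hirr : IsIrreducible κ) {V : ℕ → ℝ≥0∞}
    (hV : Tendsto V atTop (𝓝 ∞)) (hVfin : ∀ x, V x ≠ ∞) {K : ℕ}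
    (hK : ∀ x, K ≤ x → ∫⁻ y, V y ∂κ x ≤ V x) (hdown : ∀ x, K ≤ x → ∃ y < x, κ x {y} ≠ 0)
    (j : ℕ) : ⨅ n, survival κ j n j = 0 := by
  have hKpos : 0 < K := by
    rcases Nat.eq_zero_or_pos K with rfl | h
    · obtain ⟨y, hy, -⟩ := hdown 0 le_rfl
      omega
    · exact h
  set u : ℕ → ℝ≥0∞ := fun x => ⨅ n, survival κ j n x with hu
  have hu1 : ∀ x, u x ≤ 1 := fun x => (iInf_le _ 0).trans (survival_le_one 0 x)
  -- `v` is the probability of visiting `j` at a time `≥ 0`. The value `1` at `j` makes its average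
  -- after one step equal to `1 - u` everywhere, so `v` is superharmonic.
  set v : ℕ → ℝ≥0∞ := fun x => if x = j then 1 else 1 - u x with hv
  have hv1 : ∀ x, v x ≤ 1 := fun x => by
    simp only [hv]
    split_ifs
    · exact le_rfl
    · exact tsub_le_self
  have hPv : ∀ x, ∫⁻ y, v y ∂κ x + u x = 1 := fun x => by
    have h1 : u x = ∫⁻ y, Set.indicator {j}ᶜ u y ∂κ x := by
      rw [lintegral_indicator MeasurableSet.of_discrete]
      exact (tabooOp_iInf_survival x).symm
    rw [h1, ← lintegral_add_left Measurable.of_discrete]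
    have h2 : ∀ y, v y + Set.indicator {j}ᶜ u y = 1 := fun y => by
      by_cases hy : y = j
      · simp [hv, hy]
      · simp [hv, hy, tsub_add_cancel_of_le (hu1 y)]
    simp [h2]
  have hPv' : ∀ x, ∫⁻ y, v y ∂κ x ≤ v x := fun x => by
    have h1 : ∫⁻ y, v y ∂κ x = 1 - u x :=
      ENNReal.eq_sub_of_add_eq (ne_top_of_le_ne_top ENNReal.one_ne_top (hu1 x)) (hPv x)
    rw [h1]
    simp only [hv]
    split_ifs
    · exact tsub_le_self
    · exact le_rfl
  obtain ⟨z, -, hz⟩ := Finset.exists_min_image (Finset.range K) v ⟨0, by simpa using hKpos⟩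
  -- Minimum principle: `v + ε V` tends to infinity, so it has a least minimiser. At a state `≥ K`
  -- the sum is superharmonic, so all one-step successors would be minimisers too, and `hdown`
  -- provides a smaller one. Hence the minimiser is below `K`; letting `ε` tend to zero makes `z` a
  -- global minimum of `v`.
  have key : ∀ ε : ℝ≥0∞, ε ≠ 0 → ε ≠ ∞ → ∀ x, v z ≤ v x + ε * V x := by
    intro ε hε hε' x
    set s : ℕ → ℝ≥0∞ := fun x => v x + ε * V x with hs
    have hsfin : ∀ x, s x ≠ ∞ := fun x =>
      ENNReal.add_ne_top.2 ⟨ne_top_of_le_ne_top ENNReal.one_ne_top (hv1 x),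
        ENNReal.mul_ne_top hε' (hVfin x)⟩
    have hst : Tendsto s atTop (𝓝 ∞) := by
      have h1 : Tendsto (fun x => ε * V x) atTop (𝓝 ∞) := by
        have := ENNReal.Tendsto.const_mul (a := ε) hV (Or.inl ENNReal.top_ne_zero)
        rwa [ENNReal.mul_top hε] at this
      exact tendsto_of_tendsto_of_tendsto_of_le_of_le h1 tendsto_const_nhds
        (fun x => le_add_self) (fun x => le_top)
    have hmin : ∃ n, ∀ m, s n ≤ s m := by
      obtain ⟨N, hN⟩ := eventually_atTop.1 (hst.eventually (lt_mem_nhds (hsfin 0).lt_top))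
      obtain ⟨n, -, hn⟩ := Finset.exists_min_image (Finset.range (N + 1)) s ⟨0, by simp⟩
      refine ⟨n, fun m => ?_⟩
      by_cases hm : m < N + 1
      · exact hn m (Finset.mem_range.2 hm)
      · exact (hn 0 (by simp)).trans (hN m (by omega)).le
    classical
    set p := Nat.find hmin
    have hp : ∀ m, s p ≤ s m := Nat.find_spec hmin
    have hpK : p < K := by
      by_contra hcon
      obtain ⟨y, hy, hy'⟩ := hdown p (not_lt.1 hcon)
      have h1 := Nat.find_min hmin hy
      push Not at h1
      obtain ⟨m, hm⟩ := h1
      have h2 := lt_lintegral (hsfin p) hp hy' ((hp m).trans_lt hm)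
      have h3 : ∫⁻ y, s y ∂κ p ≤ s p := by
        simp only [hs]
        rw [lintegral_add_left Measurable.of_discrete, lintegral_const_mul _ Measurable.of_discrete]
        gcongr
        · exact hPv' p
        · exact hK p (not_lt.1 hcon)
      exact absurd h2 (not_lt.2 h3)
    calc v z ≤ v p := hz p (Finset.mem_range.2 hpK)
      _ ≤ s p := le_self_add
      _ ≤ s x := hp x
  have hzmin : ∀ x, v z ≤ v x := by
    intro x
    refine ENNReal.le_of_forall_pos_le_add fun δ hδ _ => ?_
    have hne : V x + 1 ≠ ∞ := ENNReal.add_ne_top.2 ⟨hVfin x, ENNReal.one_ne_top⟩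
    refine (key (δ / (V x + 1)) ?_ ?_ x).trans ?_
    · exact (ENNReal.div_pos (by exact_mod_cast hδ.ne') hne).ne'
    · exact ENNReal.div_ne_top ENNReal.coe_ne_top (by simp)
    · gcongr
      calc δ / (V x + 1) * V x ≤ δ / (V x + 1) * (V x + 1) := by gcongr; exact le_self_add
        _ = δ := ENNReal.div_mul_cancel (by simp) hne
  -- A superharmonic function keeps its minimum value along paths; the path from `z` to `j` shows
  -- that this value is `v j = 1`.
  have hprop : ∀ y, Relation.TransGen (fun x y => κ x {y} ≠ 0) z y → v y = v z := by
    have hstep : ∀ x y, v x = v z → κ x {y} ≠ 0 → v y = v z := by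
      intro x y hx hxy
      by_contra hne
      have hlt := lt_lintegral (ne_top_of_le_ne_top ENNReal.one_ne_top (hv1 z)) hzmin hxy
        (lt_of_le_of_ne (hzmin y) (Ne.symm hne))
      exact absurd hlt (not_lt.2 ((hPv' x).trans hx.le))
    intro y hy
    induction hy with
    | single h => exact hstep _ _ rfl h
    | tail _ h ih => exact hstep _ _ ih h
  have hz1 : v z = 1 := by
    rw [← hprop j (hirr z j)]
    simp [hv]
  have hge : 1 ≤ ∫⁻ y, v y ∂κ j := by
    have : ∫⁻ _, (1 : ℝ≥0∞) ∂κ j ≤ ∫⁻ y, v y ∂κ j :=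
      lintegral_mono fun y => hz1 ▸ hzmin y
    simpa using this
  have h1 : (1 : ℝ≥0∞) + u j ≤ 1 + 0 := by
    rw [add_zero]
    calc 1 + u j ≤ ∫⁻ y, v y ∂κ j + u j := by gcongr
      _ = 1 := hPv j
  exact nonpos_iff_eq_zero.1 ((ENNReal.add_le_add_iff_left ENNReal.one_ne_top).1 h1)

/-- Along a path from `x` to `j` the last step loses mass, and every earlier step inherits the loss
with positive probability. -/
theorem exists_survival_lt_one (hirr : IsIrreducible κ) (j x : ℕ) :
    ∃ n, survival κ j n x < 1 := by
  have hlt : ∀ {f : ℕ → ℝ≥0∞} {x y : ℕ}, (∀ z, f z ≤ 1) → κ x {y} ≠ 0 → f y < 1 →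
      ∫⁻ z, f z ∂κ x < 1 := by
    intro f x y hf hxy hy
    have h1 := lt_lintegral (κ := κ) (f := fun z => 1 - f z) ENNReal.zero_ne_top
      (fun _ => zero_le) hxy (tsub_pos_of_lt hy)
    have h2 : ∫⁻ z, f z ∂κ x + ∫⁻ z, (1 - f z) ∂κ x = 1 := by
      rw [← lintegral_add_left Measurable.of_discrete]
      simp [add_tsub_cancel_of_le (hf _)]
    have h3 : ∫⁻ z, f z ∂κ x ≠ ∞ :=
      ne_top_of_le_ne_top ENNReal.one_ne_top (h2 ▸ le_self_add)
    calc ∫⁻ z, f z ∂κ x < ∫⁻ z, f z ∂κ x + ∫⁻ z, (1 - f z) ∂κ x := ENNReal.lt_add_right h3 h1.ne'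
      _ = 1 := h2
  induction hirr x j using Relation.TransGen.head_induction_on with
  | @single x h =>
    refine ⟨1, ?_⟩
    rw [survival_succ]
    have : tabooOp κ j (survival κ j 0) x ≤ ∫⁻ y, (if y = j then 0 else 1) ∂κ x := by
      unfold tabooOp
      rw [← lintegral_indicator MeasurableSet.of_discrete]
      refine lintegral_mono fun y => ?_
      by_cases hy : y = j <;> simp [hy]
    refine this.trans_lt (hlt (fun z => ?_) h (by simp))
    split_ifs <;> simp
  | @head x y hxy _ ih =>
    obtain ⟨n, hn⟩ := ih
    refine ⟨n + 1, ?_⟩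
    rw [survival_succ]
    exact (tabooOp_le_lintegral x).trans_lt (hlt (survival_le_one n) hxy hn)

/-- **Foster's criterion for positive recurrence**. -/
theorem tsum_survival_ne_top (hirr : IsIrreducible κ) {V : ℕ → ℝ≥0∞} (hVfin : ∀ x, V x ≠ ∞)
    {K : ℕ} {ε : ℝ≥0∞} (hε : ε ≠ 0) (hK : ∀ x, K ≤ x → ∫⁻ y, V y ∂κ x + ε ≤ V x)
    (hF : ∀ x, x < K → ∫⁻ y, V y ∂κ x ≠ ∞) (j x : ℕ) : ∑' n, survival κ j n x ≠ ∞ := by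
  have hε' : ε ≠ ∞ := ne_top_of_le_ne_top (hVfin K) (le_add_self.trans (hK K le_rfl))
  obtain ⟨m, hm⟩ : ∃ m, ∀ x ∈ Finset.range K, survival κ j m x < 1 := by
    have : ∀ᶠ m in atTop, ∀ x ∈ Finset.range K, survival κ j m x < 1 := by
      rw [eventually_all_finset]
      intro x _
      obtain ⟨n, hn⟩ := exists_survival_lt_one hirr j x
      filter_upwards [eventually_ge_atTop n] with m hm
      exact (survival_antitone hm x).trans_lt hn
    exact this.exists
  obtain ⟨δ, hδ, hδ', hδm⟩ : ∃ δ : ℝ≥0∞, δ ≠ 0 ∧ δ ≠ ∞ ∧ ∀ x < K, survival κ j m x + δ ≤ 1 := by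
    rcases Nat.eq_zero_or_pos K with hK0 | hKpos
    · exact ⟨1, one_ne_zero, ENNReal.one_ne_top, fun x hx => by omega⟩
    · obtain ⟨z, hz, hz'⟩ := Finset.exists_max_image (Finset.range K) (survival κ j m)
        ⟨0, by simpa using hKpos⟩
      refine ⟨1 - survival κ j m z, (tsub_pos_of_lt (hm z hz)).ne',
        ne_top_of_le_ne_top ENNReal.one_ne_top tsub_le_self, fun x hx => ?_⟩
      calc survival κ j m x + (1 - survival κ j m z)
          ≤ survival κ j m z + (1 - survival κ j m z) := by
            gcongr
            exact hz' x (Finset.mem_range.2 hx)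
        _ = 1 := add_tsub_cancel_of_le (survival_le_one m z)
  -- `φ` is the mean of the hitting time of `j` truncated at `m`. One killed step lowers it by `1 -
  -- survival κ j m`: never a negative amount, and at least `δ` below `K`.
  set φ : ℕ → ℝ≥0∞ := fun x => ∑ k ∈ Finset.range m, survival κ j k x with hφ
  have hsne : ∀ n x, survival κ j n x ≠ ∞ := fun n x =>
    ne_top_of_le_ne_top ENNReal.one_ne_top (survival_le_one n x)
  have hTsum : ∀ n x, tabooOp κ j (fun y => ∑ k ∈ Finset.range n, survival κ j k y) x + 1
      = ∑ k ∈ Finset.range (n + 1), survival κ j k x := fun n x => by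
    rw [tabooOp_finset_sum, Finset.sum_range_succ']
    simp only [survival_succ, survival_zero]
  have hTφ : ∀ x, tabooOp κ j φ x + 1 = φ x + survival κ j m x := fun x => by
    rw [hTsum, Finset.sum_range_succ]
  have hTφ1 : ∀ x, tabooOp κ j φ x ≤ φ x := fun x => by
    refine (ENNReal.add_le_add_iff_right ENNReal.one_ne_top).1 ?_
    rw [hTφ]
    gcongr
    exact survival_le_one m x
  have hTφ2 : ∀ x < K, tabooOp κ j φ x + δ ≤ φ x := fun x hx => by
    refine (ENNReal.add_le_add_iff_right (hsne m x)).1 ?_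
    rw [← hTφ, add_assoc, add_comm δ]
    gcongr
    exact hδm x hx
  set B : ℝ≥0∞ := ∑ x ∈ Finset.range K, ∫⁻ y, V y ∂κ x with hB
  have hBne : B ≠ ∞ := ENNReal.sum_ne_top.2 fun x hx => hF x (Finset.mem_range.1 hx)
  -- With this weight the decrease of `C * φ` below `K` pays for the average of `V` there, which `B`
  -- bounds, and for `ε`. So `V + C * φ` drops by `ε` at every state.
  set C : ℝ≥0∞ := (B + ε) / δ with hC
  have hCne : C ≠ ∞ := ENNReal.div_ne_top (ENNReal.add_ne_top.2 ⟨hBne, hε'⟩) hδ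
  have hCδ : C * δ = B + ε := ENNReal.div_mul_cancel hδ hδ'
  set W : ℕ → ℝ≥0∞ := fun x => V x + C * φ x with hW
  have hTW : ∀ x, tabooOp κ j W x + ε ≤ W x := fun x => by
    have h1 : tabooOp κ j W x = tabooOp κ j V x + C * tabooOp κ j φ x := by
      rw [← tabooOp_const_mul, ← tabooOp_add]
    rw [h1]
    by_cases hx : x < K
    · calc tabooOp κ j V x + C * tabooOp κ j φ x + ε
          ≤ B + C * tabooOp κ j φ x + ε := by
            gcongr
            refine (tabooOp_le_lintegral x).trans ?_
            exact Finset.single_le_sum (f := fun x => ∫⁻ y, V y ∂κ x) (fun _ _ => zero_le)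
              (Finset.mem_range.2 hx)
        _ = C * (tabooOp κ j φ x + δ) := by rw [mul_add, hCδ]; ring
        _ ≤ C * φ x := by gcongr; exact hTφ2 x hx
        _ ≤ W x := le_add_self
    · calc tabooOp κ j V x + C * tabooOp κ j φ x + ε
          = (tabooOp κ j V x + ε) + C * tabooOp κ j φ x := by ring
        _ ≤ V x + C * φ x := by
            gcongr
            · exact (add_le_add_left (tabooOp_le_lintegral x) _).trans (hK x (not_lt.1 hx))
            · exact hTφ1 x
  have hbound : ∀ n x, ε * ∑ k ∈ Finset.range n, survival κ j k x ≤ W x := by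
    intro n
    induction n with
    | zero => simp
    | succ n ih =>
      intro x
      rw [← hTsum, mul_add, mul_one, ← tabooOp_const_mul]
      refine le_trans ?_ (hTW x)
      gcongr
      exact tabooOp_mono ih x
  have hWne : W x ≠ ∞ := ENNReal.add_ne_top.2 ⟨hVfin x,
    ENNReal.mul_ne_top hCne (ENNReal.sum_ne_top.2 fun k _ => hsne k x)⟩
  have hle : ε * ∑' n, survival κ j n x ≤ W x := by
    rw [ENNReal.tsum_eq_iSup_nat, ENNReal.mul_iSup]
    exact iSup_le fun n => hbound n x
  intro htop
  rw [htop, ENNReal.mul_top hε] at hle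
  exact hWne (top_le_iff.1 hle)

/-! ### Lower bounds from subharmonic functions -/

/-- A bounded subharmonic function bounds the escape probabilities from below. -/
theorem tabooOp_le_iInf_survival (hg1 : g ≤ 1) (hg : g ≤ tabooOp κ j g) (x : ℕ) :
    tabooOp κ j g x ≤ ⨅ n, survival κ j n x := by
  have h : ∀ n, g ≤ survival κ j n := fun n => by
    induction n with
    | zero => exact hg1
    | succ n ih =>
      rw [survival_succ]
      exact hg.trans (tabooOp_mono ih)
  refine le_iInf fun n => ?_
  refine le_trans ?_ (survival_succ_le n x)
  rw [survival_succ]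
  exact tabooOp_mono (h n) x

end Markov

/-- A subharmonic function below the mean return times forces these to be infinite. -/
theorem tsum_survival_eq_top_of_subharmonic (hg : g ≤ tabooOp κ j g)
    (hgW : ∀ x, g x ≤ ∑' n, survival κ j n x) {x : ℕ} (hx : tabooOp κ j g x ≠ 0) :
    ∑' n, survival κ j n x = ∞ := by
  by_contra hne
  -- Applying the killed step `n` times to the full sum leaves its tail from `n` on, while `g` can
  -- only grow.
  have h : ∀ n x, g x ≤ ∑' k, survival κ j (k + n) x := by
    intro n
    induction n with
    | zero => simpa using hgW
    | succ n ih =>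
      intro x
      refine (hg x).trans ((tabooOp_mono ih x).trans_eq ?_)
      rw [tabooOp_tsum]
      refine tsum_congr fun k => ?_
      rw [← add_assoc, survival_succ]
  -- One more killed step is taken because `g` may vanish at the starting point, as it does when `x
  -- = j` in the application.
  have h' : ∀ n, tabooOp κ j g x ≤ ∑' k, survival κ j (k + (n + 1)) x := fun n => by
    refine (tabooOp_mono (h n) x).trans_eq ?_
    rw [tabooOp_tsum]
    refine tsum_congr fun k => ?_
    rw [← add_assoc, survival_succ]
  have ht := (tendsto_add_atTop_iff_nat 1).2
    (ENNReal.tendsto_sum_nat_add (fun k => survival κ j k x) hne)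
  exact hx (nonpos_iff_eq_zero.1 (ge_of_tendsto' ht h'))

/-- A chain with down-steps of size at most one needs time `x - j` to go from `x` to `j`. -/
theorem sub_le_tsum_survival [IsMarkovKernel κ] (hskip : ∀ x y, y + 1 < x → κ x {y} = 0)
    (j x : ℕ) : ((x - j : ℕ) : ℝ≥0∞) ≤ ∑' n, survival κ j n x := by
  have h : ∀ n x, n < x - j → survival κ j n x = 1 := by
    intro n
    induction n with
    | zero => simp
    | succ n ih =>
      intro x hx
      have hae : ∀ᵐ y ∂κ x, Set.indicator {j}ᶜ (survival κ j n) y = 1 := by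
        rw [ae_iff_of_countable]
        intro y hy
        have hyx : x ≤ y + 1 := by
          by_contra hcon
          exact hy (hskip x y (by omega))
        have hyj : y ≠ j := by omega
        simp [hyj, ih y (by omega)]
      rw [survival_succ, tabooOp, ← lintegral_indicator MeasurableSet.of_discrete,
        lintegral_congr_ae hae]
      simp
  calc ((x - j : ℕ) : ℝ≥0∞) = ∑ n ∈ Finset.range (x - j), survival κ j n x := by
        rw [Finset.sum_congr rfl fun n hn => h n x (Finset.mem_range.1 hn)]
        simp
    _ ≤ ∑' n, survival κ j n x := ENNReal.sum_le_tsum _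

end MarkovChain

/-! ### The jump chain and the return times of a minimal process -/

/-- The integrand `x * exp (-x)` is the Gamma density of shape 2 and rate 1, of total mass one. -/
theorem lintegral_ofReal_expMeasure_one : ∫⁻ x, ENNReal.ofReal x ∂(expMeasure 1) = 1 := by
  rw [← lintegral_gammaPDF_eq_one (a := 2) (r := 1) two_pos one_pos]
  unfold expMeasure gammaMeasure
  rw [lintegral_withDensity_eq_lintegral_mul₀ (by unfold gammaPDF; fun_prop) (by fun_prop)]
  refine lintegral_congr fun x => ?_
  simp only [Pi.mul_apply]
  rcases lt_or_ge x 0 with hx | hx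
  · rw [gammaPDF_of_neg hx, gammaPDF_of_neg hx, zero_mul]
  · rw [gammaPDF_of_nonneg hx, gammaPDF_of_nonneg hx, ← ENNReal.ofReal_mul (by positivity)]
    congr 1
    norm_num
    ring

theorem ae_pos_expMeasure_one : ∀ᵐ x ∂(expMeasure 1), 0 < x := by
  have h : expMeasure 1 (Set.Iic 0) = 0 := by
    have hp : IsProbabilityMeasure (expMeasure 1) := isProbabilityMeasure_expMeasure one_pos
    rw [← ofReal_cdf, cdf_expMeasure_eq one_pos]
    simp
  rw [ae_iff]
  convert h using 2
  ext x
  simp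

instance : IsProbabilityMeasure (expMeasure 1) := isProbabilityMeasure_expMeasure one_pos

namespace ConservativeQMatrix

open MarkovChain

/-! ### Taboo probabilities as path probabilities -/

variable (Q : ConservativeQMatrix)

instance (i : ℕ) : IsProbabilityMeasure (Q.jumpChainLaw i) := by
  unfold jumpChainLaw
  infer_instance

instance (i : ℕ) : IsProbabilityMeasure (Q.law i) := by
  unfold law
  infer_instance

/-- The trajectories which avoid `j` at the times `1, …, n`. -/
def avoid (j n : ℕ) : Set (ℕ → ℕ) := {y | ∀ k, 1 ≤ k → k ≤ n → y k ≠ j}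

theorem measurableSet_avoid (j n : ℕ) : MeasurableSet (avoid j n) := by
  have : avoid j n = ⋂ k, ⋂ (_ : 1 ≤ k), ⋂ (_ : k ≤ n), (fun y : ℕ → ℕ => y k) ⁻¹' {j}ᶜ := by
    ext y
    simp [avoid]
  rw [this]
  exact MeasurableSet.iInter fun k => MeasurableSet.iInter fun _ => MeasurableSet.iInter fun _ =>
    measurable_pi_apply k MeasurableSet.of_discrete

theorem avoid_antitone (j : ℕ) : Antitone (avoid j) :=
  fun _ _ h _ hy k h1 h2 => hy k h1 (h2.trans h)

theorem lintegral_jumpChainLaw_zero (i : ℕ) (f : ℕ → ℝ≥0∞) :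
    ∫⁻ y, f (y 0) ∂(Q.jumpChainLaw i) = f i := by
  unfold jumpChainLaw Kernel.trajMeasure
  rw [Measure.map_dirac' (by fun_prop), Measure.dirac_bind (Kernel.measurable _)]
  have hm : Measurable fun x : Finset.Iic 0 → ℕ => f (x ⟨0, Finset.mem_Iic.2 le_rfl⟩) :=
    Measurable.of_discrete.comp (measurable_pi_apply _)
  have h := lintegral_map (μ := Kernel.traj Q.stepKernel 0
    ((MeasurableEquiv.piUnique fun _ : Finset.Iic 0 => ℕ).symm i)) hm
    (Preorder.measurable_frestrictLe (X := fun _ : ℕ => ℕ) 0)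
  refine h.symm.trans ?_
  rw [Kernel.traj_map_frestrictLe_apply, Kernel.partialTraj_self, Kernel.id_apply,
    lintegral_dirac' _ hm]
  rfl

/-- Markov property at time `n`, with `F` a function of the past. -/
theorem lintegral_jumpChainLaw_succ (i n : ℕ) {F : (Finset.Iic n → ℕ) → ℝ≥0∞} (hF : Measurable F)
    (f : ℕ → ℝ≥0∞) :
    ∫⁻ y, F (Preorder.frestrictLe n y) * f (y (n + 1)) ∂(Q.jumpChainLaw i)
      = ∫⁻ y, F (Preorder.frestrictLe n y) * ∫⁻ z, f z ∂(Q.jumpKernel (y n)) ∂(Q.jumpChainLaw i) := by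
  have h := Kernel.map_frestrictLe_trajMeasure_compProd_eq_map_trajMeasure
    (X := fun _ => ℕ) (μ₀ := Measure.dirac i) (κ := Q.stepKernel) (a := n)
  have hG : Measurable fun p : (Finset.Iic n → ℕ) × ℕ => F p.1 * f p.2 :=
    (hF.comp measurable_fst).mul (Measurable.of_discrete.comp measurable_snd)
  have h1 := congrArg (fun ν => ∫⁻ p, F p.1 * f p.2 ∂ν) h
  rw [Measure.lintegral_compProd hG, lintegral_map hG (by fun_prop),
    lintegral_map hG.lintegral_kernel_prod_right' (by fun_prop)] at h1
  unfold jumpChainLaw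
  rw [← h1]
  refine lintegral_congr fun y => Eq.symm ?_
  exact lintegral_const_mul (μ := Q.jumpKernel (y n)) (F (Preorder.frestrictLe n y))
    (Measurable.of_discrete (f := f)) |>.symm

/-- Integrating out the last step replaces `f` by `tabooOp f`. Time `0` is not constrained, so `i =
j` describes excursions away from `j`. -/
theorem setLIntegral_avoid (i j n : ℕ) (f : ℕ → ℝ≥0∞) :
    ∫⁻ y in avoid j n, f (y n) ∂(Q.jumpChainLaw i) = (tabooOp Q.jumpKernel j)^[n] f i := by
  induction n generalizing f with
  | zero =>
    have : avoid j 0 = Set.univ := by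
      ext y
      simp only [avoid, Set.mem_ofPred_eq, Set.mem_univ, iff_true]
      intro k h1 h2
      omega
    rw [this, Measure.restrict_univ]
    exact Q.lintegral_jumpChainLaw_zero i f
  | succ n ih =>
    rw [Function.iterate_succ_apply, ← ih]
    have hS : MeasurableSet {x : Finset.Iic n → ℕ | ∀ k : Finset.Iic n, 1 ≤ (k : ℕ) → x k ≠ j} :=
      MeasurableSet.of_discrete
    have h := Q.lintegral_jumpChainLaw_succ i n (F := Set.indicator
      {x : Finset.Iic n → ℕ | ∀ k : Finset.Iic n, 1 ≤ (k : ℕ) → x k ≠ j} 1) (measurable_one.indicator hS)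
      (Set.indicator {j}ᶜ f)
    have hmem : ∀ y : ℕ → ℕ, Preorder.frestrictLe n y ∈
        {x : Finset.Iic n → ℕ | ∀ k : Finset.Iic n, 1 ≤ (k : ℕ) → x k ≠ j} ↔ y ∈ avoid j n := fun y => by
      simp only [Set.mem_ofPred_eq, avoid, Subtype.forall, Finset.mem_Iic]
      exact ⟨fun h k h1 h2 => h k h2 h1, fun h k h1 h2 => h k h2 h1⟩
    have hsucc : ∀ y : ℕ → ℕ, y ∈ avoid j (n + 1) ↔ y ∈ avoid j n ∧ y (n + 1) ≠ j := fun y => by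
      constructor
      · exact fun h => ⟨fun k h1 h2 => h k h1 (by omega), h (n + 1) (by omega) le_rfl⟩
      · rintro ⟨h, h'⟩ k h1 h2
        rcases Nat.lt_or_ge k (n + 1) with hk | hk
        · exact h k h1 (by omega)
        · rwa [le_antisymm h2 hk]
    rw [← lintegral_indicator (measurableSet_avoid _ _),
      ← lintegral_indicator (measurableSet_avoid _ _)]
    have hind : ∀ y : ℕ → ℕ, Set.indicator {x : Finset.Iic n → ℕ | ∀ k : Finset.Iic n,
        1 ≤ (k : ℕ) → x k ≠ j} (1 : (Finset.Iic n → ℕ) → ℝ≥0∞) (Preorder.frestrictLe n y)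
          = (avoid j n).indicator 1 y := fun y => by
      by_cases hy : y ∈ avoid j n
      · rw [Set.indicator_of_mem hy, Set.indicator_of_mem ((hmem y).2 hy)]
        rfl
      · rw [Set.indicator_of_notMem hy, Set.indicator_of_notMem fun h => hy ((hmem y).1 h)]
    rw [lintegral_congr fun y => congrArg (· * _) (hind y),
      lintegral_congr fun y => congrArg (· * _) (hind y)] at h
    convert h using 1
    · refine lintegral_congr fun y => ?_
      by_cases h1 : y ∈ avoid j n <;> by_cases h2 : y (n + 1) = j <;>
        simp [Set.indicator, hsucc, h1, h2]
    · refine lintegral_congr fun y => ?_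
      rw [lintegral_indicator MeasurableSet.of_discrete]
      by_cases h1 : y ∈ avoid j n <;> simp [Set.indicator, h1, tabooOp]

theorem jumpChainLaw_avoid (i j n : ℕ) :
    Q.jumpChainLaw i (avoid j n) = survival Q.jumpKernel j n i := by
  rw [survival, ← setLIntegral_avoid]
  simp

theorem law_preimage_fst (i : ℕ) {S : Set (ℕ → ℕ)} (hS : MeasurableSet S) :
    Q.law i (Prod.fst ⁻¹' S) = Q.jumpChainLaw i S :=
  measurePreserving_fst.measure_preimage hS.nullMeasurableSet

/-- The probability of no return. -/
theorem law_forall_ne (i j : ℕ) :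
    Q.law i {ω | ∀ n, ω.1 ∈ avoid j n} = ⨅ n, survival Q.jumpKernel j n i := by
  have h : {ω : Path | ∀ n, ω.1 ∈ avoid j n} = Prod.fst ⁻¹' ⋂ n, avoid j n := by
    ext ω
    simp
  rw [h, law_preimage_fst _ _ (MeasurableSet.iInter fun n => measurableSet_avoid j n),
    (avoid_antitone j).measure_iInter (fun n => (measurableSet_avoid j n).nullMeasurableSet)
      ⟨0, measure_ne_top _ _⟩]
  simp only [jumpChainLaw_avoid]

theorem ae_clock_pos (i : ℕ) : ∀ᵐ ω ∂(Q.law i), ∀ n, 0 < ω.2 n := by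
  rw [ae_all_iff]
  intro n
  have h : MeasurePreserving (fun ω : Path => ω.2 n) (Q.law i) (expMeasure 1) :=
    (measurePreserving_eval_infinitePi (fun _ : ℕ => expMeasure 1) n).comp measurePreserving_snd
  exact h.quasiMeasurePreserving.ae ae_pos_expMeasure_one

/-! ### Return times as sums of holding times -/

variable {Q} {i : ℕ} {ω : Path}

theorem holdingTime_ne_zero (hω : ∀ n, 0 < ω.2 n) (n : ℕ) : Q.holdingTime n ω ≠ 0 :=
  (ENNReal.div_pos (ENNReal.ofReal_pos.2 (hω n)).ne' ENNReal.ofReal_ne_top).ne'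

theorem holdingTime_ne_top (hq : ∀ x, 0 < Q.exitRate x) (n : ℕ) : Q.holdingTime n ω ≠ ∞ :=
  ENNReal.div_ne_top ENNReal.ofReal_ne_top (ENNReal.ofReal_pos.2 (hq _)).ne'

theorem jumpTime_ne_top (hq : ∀ x, 0 < Q.exitRate x) (n : ℕ) : Q.jumpTime n ω ≠ ∞ :=
  ENNReal.sum_ne_top.2 fun k _ => holdingTime_ne_top hq k

theorem jumpTime_strictMono (hq : ∀ x, 0 < Q.exitRate x) (hω : ∀ n, 0 < ω.2 n) :
    StrictMono fun n => Q.jumpTime n ω :=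
  strictMono_nat_of_lt_succ fun n => by
    simp only [jumpTime, Finset.sum_range_succ]
    exact ENNReal.lt_add_right (jumpTime_ne_top hq n) (holdingTime_ne_zero hω n)

/-- Positive clocks make the jump times strictly increasing, so at time `J_n` the process is in its
`n`-th visited state. -/
theorem returnTime_le (hq : ∀ x, 0 < Q.exitRate x) (hω : ∀ n, 0 < ω.2 n) {n : ℕ} (hn : 1 ≤ n)
    (hi : ω.1 n = i) : Q.returnTime i ω ≤ Q.jumpTime n ω := by
  have hJ := jumpTime_strictMono hq hω
  have hne := jumpTime_ne_top (ω := ω) hq n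
  have hcoe : ((Q.jumpTime n ω).toNNReal : ℝ≥0∞) = Q.jumpTime n ω := ENNReal.coe_toNNReal hne
  have hex : ∃ m, Q.jumpTime m ω ≤ (Q.jumpTime n ω).toNNReal ∧
      ((Q.jumpTime n ω).toNNReal : ℝ≥0∞) < Q.jumpTime (m + 1) ω :=
    ⟨n, hcoe.ge, by rw [hcoe]; exact hJ (Nat.lt_succ_self n)⟩
  refine (iInf₂_le (Q.jumpTime n ω).toNNReal ⟨?_, ?_⟩).trans hcoe.le
  · rw [hcoe]
    exact hJ.monotone hn
  · classical
    unfold process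
    rw [dif_pos hex, Option.some_inj, ← hi]
    refine congrArg ω.1 ((Nat.find_eq_iff hex).2
      ⟨⟨hcoe.ge, by rw [hcoe]; exact hJ (Nat.lt_succ_self n)⟩, ?_⟩)
    rintro m hm ⟨-, h⟩
    rw [hcoe] at h
    have := hJ.lt_iff_lt.1 h
    omega

theorem le_returnTime (hq : ∀ x, 0 < Q.exitRate x) (hω : ∀ n, 0 < ω.2 n) {a : ℝ≥0∞}
    (h : ∀ n, 1 ≤ n → ω.1 n = i → a ≤ Q.jumpTime n ω) : a ≤ Q.returnTime i ω := by
  have hJ := jumpTime_strictMono hq hω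
  refine le_iInf₂ fun t ht => ?_
  obtain ⟨h1, h2⟩ := ht
  classical
  unfold process at h2
  split_ifs at h2 with hex
  obtain ⟨h3, h4⟩ := Nat.find_spec hex
  refine (h _ ?_ (Option.some_inj.1 h2)).trans h3
  have := hJ.lt_iff_lt.1 (h1.trans_lt h4)
  omega

theorem notMem_avoid {j k n : ℕ} {y : ℕ → ℕ} (hn : 1 ≤ n) (hnk : n ≤ k) (hy : y n = j) :
    y ∉ avoid j k := fun h => h n hn hnk hy

/-- The indicators select the `k` below the index `N` of the first return, so the sum is `J_N`.
Without a return the right side is `∞`. -/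
theorem tsum_indicator_le_returnTime (hq : ∀ x, 0 < Q.exitRate x) (hω : ∀ n, 0 < ω.2 n) :
    ∑' k, (Prod.fst ⁻¹' avoid i k).indicator (Q.holdingTime k) ω ≤ Q.returnTime i ω := by
  refine le_returnTime hq hω fun n hn hi => ?_
  rw [tsum_eq_sum (s := Finset.range n)]
  · exact Finset.sum_le_sum fun k _ =>
      Set.indicator_le_self (Prod.fst ⁻¹' avoid i k) (Q.holdingTime k) ω
  · intro k hk
    have hmem : ω ∉ Prod.fst ⁻¹' avoid i k :=
      notMem_avoid hn (not_lt.1 fun h => hk (Finset.mem_range.2 h)) hi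
    exact Set.indicator_of_notMem hmem (Q.holdingTime k)

/-- A return must be assumed: otherwise the sum is the explosion time, which could be finite. -/
theorem returnTime_le_tsum_indicator (hq : ∀ x, 0 < Q.exitRate x) (hω : ∀ n, 0 < ω.2 n)
    (h : ∃ n, ω.1 ∉ avoid i n) :
    Q.returnTime i ω ≤ ∑' k, (Prod.fst ⁻¹' avoid i k).indicator (Q.holdingTime k) ω := by
  have hex : ∃ n, 1 ≤ n ∧ ω.1 n = i := by
    obtain ⟨n, hn⟩ := h
    unfold avoid at hn
    simp only [Set.mem_ofPred_eq] at hn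
    push Not at hn
    obtain ⟨k, h1, -, h2⟩ := hn
    exact ⟨k, h1, h2⟩
  classical
  obtain ⟨h1, h2⟩ := Nat.find_spec hex
  refine (returnTime_le hq hω h1 h2).trans ?_
  refine le_trans (le_of_eq ?_) (ENNReal.sum_le_tsum (Finset.range (Nat.find hex)))
  refine Finset.sum_congr rfl fun k hk => (Set.indicator_of_mem ?_ _).symm
  intro m hm1 hm2 hm3
  exact Nat.find_min hex (lt_of_le_of_lt hm2 (Finset.mem_range.1 hk)) ⟨hm1, hm3⟩

theorem returnTime_lt_top_iff (hq : ∀ x, 0 < Q.exitRate x) (hω : ∀ n, 0 < ω.2 n) :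
    Q.returnTime i ω < ∞ ↔ ¬ ∀ n, ω.1 ∈ avoid i n := by
  constructor
  · intro h hall
    refine absurd h (not_lt.2 (le_returnTime hq hω fun n hn hi => ?_))
    exact absurd (hall n) (notMem_avoid hn le_rfl hi)
  · intro h
    push Not at h
    obtain ⟨n, hn⟩ := h
    simp only [avoid, Set.mem_ofPred_eq] at hn
    push Not at hn
    obtain ⟨k, h1, -, h2⟩ := hn
    exact (returnTime_le hq hω h1 h2).trans_lt (jumpTime_ne_top hq k).lt_top

theorem measurable_holdingTime (n : ℕ) : Measurable (Q.holdingTime n) := by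
  unfold holdingTime
  have h1 : Measurable fun ω : Path => ENNReal.ofReal (ω.2 n) := by fun_prop
  have h2 : Measurable fun ω : Path => ENNReal.ofReal (Q.exitRate (ω.1 n)) :=
    (Measurable.of_discrete (f := fun x => ENNReal.ofReal (Q.exitRate x))).comp (by fun_prop)
  exact h1.div h2

theorem measurable_indicator_holdingTime (j n : ℕ) :
    Measurable ((Prod.fst ⁻¹' avoid j n).indicator (Q.holdingTime n)) :=
  (measurable_holdingTime n).indicator (measurable_fst (measurableSet_avoid j n))

/-- The clocks are independent of the jump chain and have mean one, so a holding time averages to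
the inverse exit rate. -/
theorem lintegral_indicator_holdingTime (i j n : ℕ) :
    ∫⁻ ω, (Prod.fst ⁻¹' avoid j n).indicator (Q.holdingTime n) ω ∂(Q.law i)
      = (tabooOp Q.jumpKernel j)^[n] (fun x => (ENNReal.ofReal (Q.exitRate x))⁻¹) i := by
  have hf : Measurable fun y : ℕ → ℕ =>
      (avoid j n).indicator (fun y => (ENNReal.ofReal (Q.exitRate (y n)))⁻¹) y :=
    ((Measurable.of_discrete (f := fun x => (ENNReal.ofReal (Q.exitRate x))⁻¹)).comp
      (measurable_pi_apply n)).indicator (measurableSet_avoid j n)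
  have hg : Measurable fun e : ℕ → ℝ => ENNReal.ofReal (e n) := by fun_prop
  have h1 : ∀ ω : Path, (Prod.fst ⁻¹' avoid j n).indicator (Q.holdingTime n) ω
      = (avoid j n).indicator (fun y => (ENNReal.ofReal (Q.exitRate (y n)))⁻¹) ω.1
        * ENNReal.ofReal (ω.2 n) := fun ω => by
    by_cases h : ω.1 ∈ avoid j n
    · simp [Set.indicator, h, holdingTime, div_eq_mul_inv, mul_comm]
    · simp [Set.indicator, h]
  have h2 : ∫⁻ e : ℕ → ℝ, ENNReal.ofReal (e n) ∂(Measure.infinitePi fun _ => expMeasure 1) = 1 := by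
    rw [(measurePreserving_eval_infinitePi (fun _ : ℕ => expMeasure 1) n).lintegral_comp
      (f := fun x => ENNReal.ofReal x) (by fun_prop)]
    exact lintegral_ofReal_expMeasure_one
  simp only [h1]
  unfold law
  rw [lintegral_prod_mul hf.aemeasurable hg.aemeasurable, h2, mul_one,
    lintegral_indicator (measurableSet_avoid j n), ← setLIntegral_avoid]

theorem isRecurrent_iff (hq : ∀ x, 0 < Q.exitRate x) :
    Q.IsRecurrent ↔ ∀ i, ⨅ n, survival Q.jumpKernel i n i = 0 := by
  refine forall_congr' fun i => ?_
  rw [or_iff_right (hq i).ne', ← law_forall_ne]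
  have hm : MeasurableSet {ω : Path | ∀ n, ω.1 ∈ avoid i n} := by
    have h : {ω : Path | ∀ n, ω.1 ∈ avoid i n} = ⋂ n, Prod.fst ⁻¹' avoid i n := by
      ext ω
      simp
    rw [h]
    exact MeasurableSet.iInter fun n => measurable_fst (measurableSet_avoid i n)
  rw [← prob_compl_eq_one_iff hm]
  refine Eq.congr_left (measure_congr ?_)
  filter_upwards [Q.ae_clock_pos i] with ω hω
  exact propext (returnTime_lt_top_iff hq hω)

theorem iterate_tabooOp_const {κ : Kernel ℕ ℕ} (j n : ℕ) (a : ℝ≥0∞) :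
    (tabooOp κ j)^[n] (fun _ => a) = fun x => a * survival κ j n x := by
  induction n with
  | zero => simp
  | succ n ih =>
    rw [Function.iterate_succ_apply', ih, survival_succ]
    funext x
    exact tabooOp_const_mul a x

/-- Mean holding times lie between `1 / b` and `1 / a`, so the mean return time and the mean number
of jumps before return bound each other. -/
theorem isPositiveRecurrent_iff (hq : ∀ x, 0 < Q.exitRate x) {a b : ℝ} (ha : 0 < a)
    (hqa : ∀ x, a ≤ Q.exitRate x) (hqb : ∀ x, Q.exitRate x ≤ b) :
    Q.IsPositiveRecurrent ↔ ∀ i, ∑' n, survival Q.jumpKernel i n i ≠ ∞ := by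
  have hb : 0 < b := (hq 0).trans_le (hqb 0)
  refine forall_congr' fun i => ?_
  rw [or_iff_right (hq i).ne', lt_top_iff_ne_top, not_iff_not]
  have hmono : ∀ n, Monotone ((tabooOp Q.jumpKernel i)^[n]) := fun n =>
    Monotone.iterate (fun _ _ h => tabooOp_mono h) n
  constructor
  · intro htop
    by_contra hfin
    -- A finite mean number of jumps forces almost sure return, which the upper bound on the return
    -- time needs.
    have h0 : ⨅ n, survival Q.jumpKernel i n i = 0 :=
      iInf_eq_of_tendsto (fun _ _ h => survival_antitone h i)
        (ENNReal.tendsto_atTop_zero_of_tsum_ne_top hfin)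
    rw [← law_forall_ne] at h0
    have hle : ∫⁻ ω, Q.returnTime i ω ∂(Q.law i)
        ≤ ∫⁻ ω, ∑' k, (Prod.fst ⁻¹' avoid i k).indicator (Q.holdingTime k) ω ∂(Q.law i) := by
      refine lintegral_mono_ae ?_
      filter_upwards [Q.ae_clock_pos i, measure_eq_zero_iff_ae_notMem.1 h0] with ω h1 h2
      refine returnTime_le_tsum_indicator hq h1 ?_
      simpa using h2
    rw [htop, top_le_iff,
      lintegral_tsum fun k => (measurable_indicator_holdingTime i k).aemeasurable] at hle
    simp only [lintegral_indicator_holdingTime] at hle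
    have hle2 : ∑' n, (tabooOp Q.jumpKernel i)^[n] (fun x => (ENNReal.ofReal (Q.exitRate x))⁻¹) i
        ≤ ∑' n, (ENNReal.ofReal a)⁻¹ * survival Q.jumpKernel i n i := by
      refine ENNReal.tsum_le_tsum fun n => ?_
      refine (hmono n (fun x => ENNReal.inv_le_inv.2 (ENNReal.ofReal_le_ofReal (hqa x))) i).trans ?_
      rw [iterate_tabooOp_const]
    rw [hle, ENNReal.tsum_mul_left, top_le_iff] at hle2
    exact ENNReal.mul_ne_top (ENNReal.inv_ne_top.2 (ENNReal.ofReal_pos.2 ha).ne') hfin hle2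
  · intro htop
    have hle : ∫⁻ ω, ∑' k, (Prod.fst ⁻¹' avoid i k).indicator (Q.holdingTime k) ω ∂(Q.law i)
        ≤ ∫⁻ ω, Q.returnTime i ω ∂(Q.law i) := by
      refine lintegral_mono_ae ?_
      filter_upwards [Q.ae_clock_pos i] with ω h1
      exact tsum_indicator_le_returnTime hq h1
    rw [lintegral_tsum fun k => (measurable_indicator_holdingTime i k).aemeasurable] at hle
    simp only [lintegral_indicator_holdingTime] at hle
    have hle2 : ∑' n, (ENNReal.ofReal b)⁻¹ * survival Q.jumpKernel i n i
        ≤ ∑' n, (tabooOp Q.jumpKernel i)^[n] (fun x => (ENNReal.ofReal (Q.exitRate x))⁻¹) i := by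
      refine ENNReal.tsum_le_tsum fun n => ?_
      refine le_trans ?_ (hmono n
        (fun x => ENNReal.inv_le_inv.2 (ENNReal.ofReal_le_ofReal (hqb x))) i)
      rw [iterate_tabooOp_const]
    rw [ENNReal.tsum_mul_left, htop,
      ENNReal.mul_top (ENNReal.inv_ne_zero.2 ENNReal.ofReal_ne_top)] at hle2
    exact top_le_iff.1 (hle2.trans hle)

end ConservativeQMatrix

/-! ### The jump chain of the queue -/

namespace ConservativeQMatrix

variable {Q : ConservativeQMatrix}

theorem jumpKernel_singleton (x y : ℕ) :
    Q.jumpKernel x {y} = ENNReal.ofReal (Q.jumpProb x y) :=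
  PMF.toMeasure_apply_singleton _ _ MeasurableSet.of_discrete

theorem jumpKernel_singleton_eq_zero {x y : ℕ} (hq : 0 < Q.exitRate x) (hxy : y ≠ x)
    (h : Q.rate x y = 0) : Q.jumpKernel x {y} = 0 := by
  simp [jumpKernel_singleton, jumpProb, hq.ne', hxy, h]

theorem jumpKernel_singleton_ne_zero {x y : ℕ} (hq : 0 < Q.exitRate x) (hxy : y ≠ x)
    (h : 0 < Q.rate x y) : Q.jumpKernel x {y} ≠ 0 := by
  simp only [jumpKernel_singleton, jumpProb, hq.ne', hxy, if_false]
  exact (ENNReal.ofReal_pos.2 (div_pos h hq)).ne'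

theorem exitRate_mul_lintegral {x : ℕ} (hq : 0 < Q.exitRate x) (f : ℕ → ℝ≥0∞) :
    ENNReal.ofReal (Q.exitRate x) * ∫⁻ y, f y ∂(Q.jumpKernel x)
      = ∑' y, (if y = x then 0 else ENNReal.ofReal (Q.rate x y)) * f y := by
  rw [lintegral_countable', ← ENNReal.tsum_mul_left]
  refine tsum_congr fun y => ?_
  rw [jumpKernel_singleton]
  by_cases h : y = x
  · simp [jumpProb, hq.ne', h]
  · simp only [jumpProb, hq.ne', h, if_false]
    rw [mul_comm (f y), ← mul_assoc, ← ENNReal.ofReal_mul hq.le, mul_div_cancel₀ _ hq.ne']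

end ConservativeQMatrix

namespace BulkQueue

open MarkovChain ConservativeQMatrix

variable (M : BulkQueue)

theorem hasSum_b_add_two : HasSum (fun k => M.b (k + 2)) (-M.b 1 - M.b 0) := by
  have h := (hasSum_nat_add_iff' 2).2 M.hasSum_b
  simp only [Finset.sum_range_succ, Finset.sum_range_zero] at h
  rwa [show (0 : ℝ) - (0 + M.b 0 + M.b 1) = -M.b 1 - M.b 0 by ring] at h

theorem b_add_two_nonneg (k : ℕ) : 0 ≤ M.b (k + 2) := M.b_nonneg _ (by omega)

theorem neg_b_one_pos : 0 < -M.b 1 := by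
  have h := M.tsum_b_pos
  rw [M.hasSum_b_add_two.tsum_eq] at h
  linarith [M.b_zero_pos]

theorem exitRate_zero : M.qMatrix.exitRate 0 = ∑' k, M.h k := by
  simp [exitRate, qMatrix, rateStar, rateRes]

theorem exitRate_succ (i : ℕ) : M.qMatrix.exitRate (i + 1)
    = -M.b 1 + (((min (i + 1) M.c : ℕ) : ℝ) - 1) * M.b 0 := by
  simp [exitRate, qMatrix, rateStar, rateRes]
  ring

theorem one_le_min (i : ℕ) : (1 : ℝ) ≤ ((min (i + 1) M.c : ℕ) : ℝ) := by
  exact_mod_cast le_min (by omega) M.one_le_c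

theorem le_exitRate (x : ℕ) : min (∑' k, M.h k) (-M.b 1) ≤ M.qMatrix.exitRate x := by
  cases x with
  | zero => exact (min_le_left _ _).trans M.exitRate_zero.ge
  | succ i =>
    refine (min_le_right _ _).trans ?_
    rw [exitRate_succ]
    have := mul_nonneg (sub_nonneg.2 (M.one_le_min i)) M.b_zero_pos.le
    linarith

theorem exitRate_le (x : ℕ) :
    M.qMatrix.exitRate x ≤ max (∑' k, M.h k) (-M.b 1 + ((M.c : ℝ) - 1) * M.b 0) := by
  cases x with
  | zero => exact M.exitRate_zero.le.trans (le_max_left _ _)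
  | succ i =>
    refine le_trans ?_ (le_max_right _ _)
    rw [exitRate_succ]
    have h1 : ((min (i + 1) M.c : ℕ) : ℝ) ≤ M.c := by exact_mod_cast min_le_right _ _
    have := M.b_zero_pos
    gcongr

theorem min_rate_pos : 0 < min (∑' k, M.h k) (-M.b 1) := lt_min M.tsum_h_pos M.neg_b_one_pos

theorem exitRate_pos (x : ℕ) : 0 < M.qMatrix.exitRate x := M.min_rate_pos.trans_le (M.le_exitRate x)

theorem ofReal_exitRate_ne_zero (x : ℕ) : ENNReal.ofReal (M.qMatrix.exitRate x) ≠ 0 :=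
  (ENNReal.ofReal_pos.2 (M.exitRate_pos x)).ne'

theorem rate_down (i : ℕ) : M.qMatrix.rate (i + 1) i = ((min (i + 1) M.c : ℕ) : ℝ) * M.b 0 := by
  simp [qMatrix, rateStar, rateRes]

theorem rate_up (i k : ℕ) : M.qMatrix.rate (i + 1) (i + 2 + k) = M.b (k + 2) := by
  have h1 : ¬ (i + 2 + k = i) := by omega
  have h2 : ¬ (i + 2 + k + 1 = i + 1) := by omega
  have h3 : ¬ (i + 2 + k = i + 1) := by omega
  have h4 : i + 1 + 1 ≤ i + 2 + k := by omega
  have h5 : i + 2 + k - (i + 1) + 1 = k + 2 := by omega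
  simp only [qMatrix, rateStar, rateRes, h2, h3, h4, h5]
  simp

theorem rate_zero {j : ℕ} (hj : j ≠ 0) : M.qMatrix.rate 0 j = M.h j := by
  have : 1 ≤ j := by omega
  simp [qMatrix, rateStar, rateRes, hj, this]

theorem rate_eq_zero {x y : ℕ} (h : y + 1 < x) : M.qMatrix.rate x y = 0 := by
  have h1 : ¬ (y + 1 = x) := by omega
  have h2 : ¬ (y = x) := by omega
  have h3 : ¬ (x + 1 ≤ y) := by omega
  have h4 : ¬ (x = 0) := by omega
  simp only [qMatrix, rateStar, rateRes, h1, h2, h3, h4]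
  simp

/-! ### The generator of the queue and irreducibility -/

theorem exitRate_zero_mul_lintegral (f : ℕ → ℝ≥0∞) :
    ENNReal.ofReal (M.qMatrix.exitRate 0) * ∫⁻ y, f y ∂(M.qMatrix.jumpKernel 0)
      = ∑' j, ENNReal.ofReal (M.h j) * f j := by
  rw [exitRate_mul_lintegral (M.exitRate_pos 0)]
  refine tsum_congr fun j => ?_
  by_cases hj : j = 0
  · simp [hj, M.h_zero]
  · rw [if_neg hj, M.rate_zero hj]

theorem exitRate_succ_mul_lintegral (i : ℕ) (f : ℕ → ℝ≥0∞) :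
    ENNReal.ofReal (M.qMatrix.exitRate (i + 1)) * ∫⁻ y, f y ∂(M.qMatrix.jumpKernel (i + 1))
      = ENNReal.ofReal (((min (i + 1) M.c : ℕ) : ℝ) * M.b 0) * f i
        + ∑' k, ENNReal.ofReal (M.b (k + 2)) * f (i + 2 + k) := by
  rw [exitRate_mul_lintegral (M.exitRate_pos _)]
  have hinj : Function.Injective fun k : ℕ => k + i := fun x y hxy => by simpa using hxy
  -- Nothing below `i` is reachable in one jump. Counted from `i`, the terms are the service, the
  -- diagonal (zero) and the arrivals.
  rw [← hinj.tsum_eq, tsum_eq_zero_add' ENNReal.summable,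
    tsum_eq_zero_add' ENNReal.summable]
  · have h0 : ¬ (0 + i = i + 1) := by omega
    have h1 : 0 + 1 + i = i + 1 := by omega
    have h2 : ∀ k, ¬ (k + 1 + 1 + i = i + 1) := fun k => by omega
    have h3 : ∀ k, k + 1 + 1 + i = i + 2 + k := fun k => by omega
    have h4 : ∀ k, ¬ (i + 2 + k = i + 1) := fun k => by omega
    rw [if_neg h0, if_pos h1, zero_add, zero_mul, zero_add, M.rate_down]
    simp only [h3, h4, if_false, M.rate_up]
  · intro y hy
    by_contra hcon
    have hlt : y + 1 < i + 1 := by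
      by_contra h
      exact hcon ⟨y - i, by simp only; omega⟩
    refine hy ?_
    simp [M.rate_eq_zero hlt]

theorem jumpKernel_down (i : ℕ) : M.qMatrix.jumpKernel (i + 1) {i} ≠ 0 := by
  refine jumpKernel_singleton_ne_zero (M.exitRate_pos _) (by omega) ?_
  rw [rate_down]
  exact mul_pos (by linarith [M.one_le_min i]) M.b_zero_pos

theorem exists_jumpKernel_up (x : ℕ) : ∃ y, x < y ∧ M.qMatrix.jumpKernel x {y} ≠ 0 := by
  cases x with
  | zero =>
    obtain ⟨j, hj⟩ : ∃ j, M.h j ≠ 0 := by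
      by_contra! hcon
      have := M.tsum_h_pos
      simp [hcon] at this
    have hj0 : j ≠ 0 := fun h => hj (h ▸ M.h_zero)
    refine ⟨j, by omega, jumpKernel_singleton_ne_zero (M.exitRate_pos _) hj0 ?_⟩
    rw [M.rate_zero hj0]
    exact lt_of_le_of_ne (M.h_nonneg j) hj.symm
  | succ i =>
    obtain ⟨k, hk⟩ : ∃ k, M.b (k + 2) ≠ 0 := by
      by_contra! hcon
      have := M.tsum_b_pos
      simp [hcon] at this
    refine ⟨i + 2 + k, by omega, jumpKernel_singleton_ne_zero (M.exitRate_pos _) (by omega) ?_⟩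
    rw [M.rate_up]
    exact lt_of_le_of_ne (M.b_add_two_nonneg k) hk.symm

theorem jumpKernel_skipFree (x y : ℕ) (h : y + 1 < x) : M.qMatrix.jumpKernel x {y} = 0 :=
  jumpKernel_singleton_eq_zero (M.exitRate_pos x) (by omega) (M.rate_eq_zero h)

/-- Upward jumps lead above any target, and single down-steps then reach it. -/
theorem irreducible : IsIrreducible M.qMatrix.jumpKernel := by
  have hdown : ∀ n y, Relation.TransGen (fun x y => M.qMatrix.jumpKernel x {y} ≠ 0)
      (y + n + 1) y := by
    intro n y
    induction n with
    | zero => exact Relation.TransGen.single (M.jumpKernel_down y)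
    | succ n ih => exact Relation.TransGen.head (M.jumpKernel_down (y + n + 1)) ih
  have hup : ∀ n x, ∃ y, x + n < y ∧
      Relation.TransGen (fun x y => M.qMatrix.jumpKernel x {y} ≠ 0) x y := by
    intro n x
    induction n with
    | zero =>
      obtain ⟨y, hy, h⟩ := M.exists_jumpKernel_up x
      exact ⟨y, hy, Relation.TransGen.single h⟩
    | succ n ih =>
      obtain ⟨y, hy, h⟩ := ih
      obtain ⟨z, hz, h'⟩ := M.exists_jumpKernel_up y
      exact ⟨z, by omega, h.tail h'⟩
  intro x y
  obtain ⟨z, hz, h⟩ := hup y x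
  have h' := hdown (z - y - 1) y
  rw [show y + (z - y - 1) + 1 = z by omega] at h'
  exact h.trans h'

/-! ### The drift -/

/-- The total rate of upward movement from a state `i ≥ 1`. -/
noncomputable def upDrift : ℝ≥0∞ := ∑' k : ℕ, ((k : ℝ≥0∞) + 1) * ENNReal.ofReal (M.b (k + 2))

/-- The total rate of the upward jumps from a state `i ≥ 1`. -/
noncomputable def upRate : ℝ≥0∞ := ∑' k : ℕ, ENNReal.ofReal (M.b (k + 2))

theorem ofReal_exitRate_succ (i : ℕ) : ENNReal.ofReal (M.qMatrix.exitRate (i + 1))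
    = ENNReal.ofReal (((min (i + 1) M.c : ℕ) : ℝ) * M.b 0) + M.upRate := by
  simpa [upRate] using M.exitRate_succ_mul_lintegral i 1

/-- The action of the generator on a function which is affine above `i`. -/
theorem exitRate_succ_mul_lintegral_affine (i : ℕ) (f : ℕ → ℝ≥0∞)
    (hf : ∀ k, f (i + k) = f i + k) :
    ENNReal.ofReal (M.qMatrix.exitRate (i + 1)) * ∫⁻ y, f y ∂(M.qMatrix.jumpKernel (i + 1))
      + ENNReal.ofReal (((min (i + 1) M.c : ℕ) : ℝ) * M.b 0)
      = ENNReal.ofReal (M.qMatrix.exitRate (i + 1)) * f (i + 1) + M.upDrift := by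
  -- Upward jumps are measured from level `i + 1`, where `f` equals `f i + 1`; the excess `k + 1`
  -- sums to the drift.
  have h : ∑' k, ENNReal.ofReal (M.b (k + 2)) * f (i + 2 + k)
      = M.upRate * (f i + 1) + M.upDrift := by
    rw [upRate, upDrift, ← ENNReal.tsum_mul_right, ← ENNReal.tsum_add]
    refine tsum_congr fun k => ?_
    rw [add_assoc i, hf]
    push_cast
    ring
  rw [exitRate_succ_mul_lintegral, h, M.ofReal_exitRate_succ, hf 1]
  push_cast
  ring

theorem genBc_one : M.genBc 1 = 0 := by
  simp [genBc, genB, M.hasSum_b.tsum_eq]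

/-- Expand `(s ^ j - 1) / (s - 1)` as a geometric sum and subtract `∑ b_j = 0`. This removes the
sign-indefinite `b_1`, leaving nonnegative terms that increase to those of `upDrift` as `s` tends to
`1`. -/
theorem hasSum_slope {s : ℝ} (h0 : 0 < s) (h1 : s < 1) :
    HasSum (fun k => M.b (k + 2) * ∑ l ∈ Finset.range (k + 1), s ^ (l + 1))
      ((M.genBc s - M.genBc 1) / (s - 1) + M.c * M.b 0) := by
  have hne : s - 1 ≠ 0 := by linarith
  have a := ((M.summable_b_mul_pow h0.le h1.le).hasSum.sub M.hasSum_b).div_const (s - 1)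
  have h := (hasSum_nat_add_iff' 2).2 (a.sub M.hasSum_b)
  have e1 : (fun k => M.b (k + 2) * ∑ l ∈ Finset.range (k + 1), s ^ (l + 1))
      = fun k => (M.b (k + 2) * s ^ (k + 2) - M.b (k + 2)) / (s - 1) - M.b (k + 2) := by
    funext k
    have h2 := geom_sum_eq (x := s) (by linarith) (k + 2)
    rw [Finset.sum_range_succ'] at h2
    simp only [pow_zero] at h2
    rw [eq_sub_of_add_eq h2]
    ring
  have e2 : (M.genBc s - M.genBc 1) / (s - 1) + M.c * M.b 0
      = (∑' j, M.b j * s ^ j - 0) / (s - 1) - 0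
        - ∑ j ∈ Finset.range 2, ((M.b j * s ^ j - M.b j) / (s - 1) - M.b j) := by
    rw [genBc_one, genBc, genB]
    simp only [Finset.sum_range_succ, Finset.sum_range_zero]
    field_simp
    ring
  rw [e1, e2]
  exact h

theorem slope_le_derivBcOne {s : ℝ} (h0 : 0 < s) (h1 : s < 1) :
    (((M.genBc s - M.genBc 1) / (s - 1) : ℝ) : EReal) ≤ M.derivBcOne := by
  refine ge_of_tendsto M.tendsto_derivBcOne ?_
  filter_upwards [Ioo_mem_nhdsLT h1] with t ht
  exact EReal.coe_le_coe_iff.2 (M.slope_monotoneOn ⟨h0, h1⟩ ⟨h0.trans ht.1, ht.2⟩ ht.1.le)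

/-- This encodes `B_c'(1) + c b_0 = upDrift`, infinite values included. The condition `hL` prevents
`ENNReal.ofReal` from truncating. -/
theorem derivBcOne_le_iff {L : ℝ} (hL : 0 ≤ L + M.c * M.b 0) :
    M.derivBcOne ≤ L ↔ M.upDrift ≤ ENNReal.ofReal (L + M.c * M.b 0) := by
  constructor
  · intro h
    refine ENNReal.tsum_le_of_sum_range_le fun n => ?_
    have hcont : Tendsto (fun s : ℝ => ∑ k ∈ Finset.range n,
        M.b (k + 2) * ∑ l ∈ Finset.range (k + 1), s ^ (l + 1)) (𝓝[<] 1)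
        (𝓝 (∑ k ∈ Finset.range n,
          M.b (k + 2) * ∑ l ∈ Finset.range (k + 1), (1 : ℝ) ^ (l + 1))) := by
      refine Tendsto.mono_left (Continuous.tendsto ?_ 1) nhdsWithin_le_nhds
      fun_prop
    have hle : ∑ k ∈ Finset.range n, M.b (k + 2) * ∑ l ∈ Finset.range (k + 1), (1 : ℝ) ^ (l + 1)
        ≤ L + M.c * M.b 0 := by
      refine le_of_tendsto hcont ?_
      filter_upwards [Ioo_mem_nhdsLT (zero_lt_one' ℝ)] with s hs
      have h1 := EReal.coe_le_coe_iff.1 ((M.slope_le_derivBcOne hs.1 hs.2).trans h)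
      refine (sum_le_hasSum _ (fun k _ => ?_) (M.hasSum_slope hs.1 hs.2)).trans (by linarith)
      exact mul_nonneg (M.b_add_two_nonneg k)
        (Finset.sum_nonneg fun l _ => pow_nonneg hs.1.le _)
    refine le_trans (le_of_eq ?_) (ENNReal.ofReal_le_ofReal hle)
    rw [ENNReal.ofReal_sum_of_nonneg fun k _ => mul_nonneg (M.b_add_two_nonneg k) (by positivity)]
    refine Finset.sum_congr rfl fun k _ => ?_
    rw [ENNReal.ofReal_mul (M.b_add_two_nonneg k), mul_comm]
    congr 1
    simp only [one_pow, Finset.sum_const, Finset.card_range, nsmul_eq_mul, mul_one]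
    rw [ENNReal.ofReal_natCast]
    push_cast
    rfl
  · intro h
    refine le_of_tendsto M.tendsto_derivBcOne ?_
    filter_upwards [Ioo_mem_nhdsLT (zero_lt_one' ℝ)] with s hs
    rw [EReal.coe_le_coe_iff]
    have hsum := M.hasSum_slope hs.1 hs.2
    have hnn : ∀ k, 0 ≤ M.b (k + 2) * ∑ l ∈ Finset.range (k + 1), s ^ (l + 1) := fun k =>
      mul_nonneg (M.b_add_two_nonneg k) (Finset.sum_nonneg fun l _ => pow_nonneg hs.1.le _)
    have h1 : ENNReal.ofReal ((M.genBc s - M.genBc 1) / (s - 1) + M.c * M.b 0)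
        ≤ ENNReal.ofReal (L + M.c * M.b 0) := by
      rw [← hsum.tsum_eq, ENNReal.ofReal_tsum_of_nonneg hnn hsum.summable]
      refine (ENNReal.tsum_le_tsum fun k => ?_).trans h
      rw [ENNReal.ofReal_mul (M.b_add_two_nonneg k), mul_comm]
      gcongr
      refine ENNReal.ofReal_le_of_le_toReal ?_
      have h2 : ((k : ℝ≥0∞) + 1).toReal = k + 1 := by
        rw [ENNReal.toReal_add (ENNReal.natCast_ne_top k) ENNReal.one_ne_top]
        simp
      rw [h2]
      calc ∑ l ∈ Finset.range (k + 1), s ^ (l + 1) ≤ ∑ l ∈ Finset.range (k + 1), (1 : ℝ) :=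
            Finset.sum_le_sum fun l _ => pow_le_one₀ hs.1.le hs.2.le
        _ = k + 1 := by simp
    have := (ENNReal.ofReal_le_ofReal_iff hL).1 h1
    linarith

theorem derivBcOne_nonpos_iff :
    M.derivBcOne ≤ 0 ↔ M.upDrift ≤ ENNReal.ofReal (M.c * M.b 0) := by
  have h := M.derivBcOne_le_iff (L := 0)
    (by have := M.b_zero_pos; positivity)
  simpa using h

/-! ### Recurrence and positive recurrence of the jump chain -/

theorem min_eq_c {i : ℕ} (hi : M.c ≤ i + 1) : min (i + 1) M.c = M.c := min_eq_right hi

theorem iInf_survival_eq_zero_of_derivBcOne_nonpos (h : M.derivBcOne ≤ 0) (j : ℕ) :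
    ⨅ n, survival M.qMatrix.jumpKernel j n j = 0 := by
  rw [derivBcOne_nonpos_iff] at h
  refine iInf_survival_eq_zero M.irreducible (V := fun x => (x : ℝ≥0∞)) (K := M.c)
    ENNReal.tendsto_nat_nhds_top (fun x => ENNReal.natCast_ne_top x) ?_ ?_ j
  · intro x hx
    obtain ⟨i, rfl⟩ : ∃ i, x = i + 1 := ⟨x - 1, by have := M.one_le_c; omega⟩
    have h1 := M.exitRate_succ_mul_lintegral_affine i (fun x => (x : ℝ≥0∞)) (by simp)
    rw [M.min_eq_c hx] at h1
    refine (ENNReal.mul_le_mul_iff_right (M.ofReal_exitRate_ne_zero (i + 1))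
      ENNReal.ofReal_ne_top).1 ?_
    refine (ENNReal.add_le_add_iff_right (a := ENNReal.ofReal (M.c * M.b 0))
      ENNReal.ofReal_ne_top).1 ?_
    rw [h1]
    gcongr
  · intro x hx
    obtain ⟨i, rfl⟩ : ∃ i, x = i + 1 := ⟨x - 1, by have := M.one_le_c; omega⟩
    exact ⟨i, by omega, M.jumpKernel_down i⟩

theorem tsum_survival_ne_top_of_derivBcOne_neg (h : M.derivBcOne < 0) (hμ : M.muOne < ∞) (j : ℕ) :
    ∑' n, survival M.qMatrix.jumpKernel j n j ≠ ∞ := by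
  obtain ⟨L₀, hL₀, hL₀'⟩ := EReal.lt_iff_exists_real_btwn.1 h
  have hcb : 0 < M.c * M.b 0 := mul_pos (by exact_mod_cast M.one_le_c) M.b_zero_pos
  obtain ⟨L, hL, hL1, hL2⟩ : ∃ L : ℝ, M.derivBcOne ≤ L ∧ L < 0 ∧ 0 ≤ L + M.c * M.b 0 := by
    -- Clipping at `-c b_0` meets the sign condition of `derivBcOne_le_iff`.
    refine ⟨max L₀ (-(M.c * M.b 0)), hL₀.le.trans (EReal.coe_le_coe_iff.2 (le_max_left _ _)),
      max_lt (by exact_mod_cast hL₀') (by linarith), ?_⟩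
    linarith [le_max_right L₀ (-(M.c * M.b 0))]
  rw [M.derivBcOne_le_iff hL2] at hL
  set q := ENNReal.ofReal (max (∑' k, M.h k) (-M.b 1 + ((M.c : ℝ) - 1) * M.b 0)) with hq
  have hq0 : q ≠ 0 :=
    (ENNReal.ofReal_pos.2 ((M.exitRate_pos 0).trans_le (M.exitRate_le 0))).ne'
  have hqt : q ≠ ∞ := ENNReal.ofReal_ne_top
  have hdrift : M.upDrift + ENNReal.ofReal (-L) ≤ ENNReal.ofReal (M.c * M.b 0) := by
    refine (add_le_add_left hL _).trans ?_
    rw [← ENNReal.ofReal_add hL2 (by linarith)]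
    exact ENNReal.ofReal_le_ofReal (by linarith)
  -- The drift per unit time is at most `L`; dividing `-L` by the bound `q` on the exit rates gives
  -- a decrease per jump.
  refine tsum_survival_ne_top M.irreducible (V := fun x => (x : ℝ≥0∞)) (K := M.c)
    (ε := ENNReal.ofReal (-L) / q) (fun x => ENNReal.natCast_ne_top x)
    (ENNReal.div_pos (ENNReal.ofReal_pos.2 (by linarith)).ne' hqt).ne' ?_ ?_ j j
  · intro x hx
    obtain ⟨i, rfl⟩ : ∃ i, x = i + 1 := ⟨x - 1, by have := M.one_le_c; omega⟩
    have h1 := M.exitRate_succ_mul_lintegral_affine i (fun x => (x : ℝ≥0∞)) (by simp)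
    rw [M.min_eq_c hx] at h1
    refine (ENNReal.mul_le_mul_iff_right (M.ofReal_exitRate_ne_zero (i + 1))
      ENNReal.ofReal_ne_top).1 ?_
    refine (ENNReal.add_le_add_iff_right (a := ENNReal.ofReal (M.c * M.b 0))
      ENNReal.ofReal_ne_top).1 ?_
    rw [mul_add, add_right_comm, h1, add_assoc]
    gcongr
    refine le_trans ?_ hdrift
    gcongr
    calc ENNReal.ofReal (M.qMatrix.exitRate (i + 1)) * (ENNReal.ofReal (-L) / q)
        ≤ q * (ENNReal.ofReal (-L) / q) := by
          gcongr
          exact ENNReal.ofReal_le_ofReal (M.exitRate_le _)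
      _ = ENNReal.ofReal (-L) := ENNReal.mul_div_cancel hq0 hqt
  · intro x _ htop
    cases x with
    | zero =>
      have h1 := M.exitRate_zero_mul_lintegral fun x => (x : ℝ≥0∞)
      rw [htop, ENNReal.mul_top (M.ofReal_exitRate_ne_zero 0)] at h1
      refine hμ.ne ?_
      rw [muOne, h1]
      exact tsum_congr fun j => mul_comm _ _
    | succ i =>
      have h1 := M.exitRate_succ_mul_lintegral_affine i (fun x => (x : ℝ≥0∞)) (by simp)
      rw [htop, ENNReal.mul_top (M.ofReal_exitRate_ne_zero (i + 1)), top_add] at h1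
      refine ENNReal.add_ne_top.2 ⟨?_, ?_⟩ h1.symm
      · exact ENNReal.mul_ne_top ENNReal.ofReal_ne_top (ENNReal.natCast_ne_top _)
      · exact ne_top_of_le_ne_top ENNReal.ofReal_ne_top hL

/-! ### Converse directions -/

theorem tabooOp_pred_c_ne_zero {g : ℕ → ℝ≥0∞} (hg0 : g (M.c - 1) = 0)
    (hg : ∀ y, M.c ≤ y → g y ≠ 0) :
    tabooOp M.qMatrix.jumpKernel (M.c - 1) g (M.c - 1) ≠ 0 := by
  rw [tabooOp_eq_lintegral hg0]
  obtain ⟨y, hy, hxy⟩ := M.exists_jumpKernel_up (M.c - 1)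
  exact (lt_lintegral ENNReal.zero_ne_top (fun _ => zero_le) hxy
    (pos_iff_ne_zero.2 (hg y (by omega)))).ne'

theorem tsum_survival_eq_top (h : ¬ M.derivBcOne < 0) :
    ∑' n, survival M.qMatrix.jumpKernel (M.c - 1) n (M.c - 1) = ∞ := by
  have hc := M.one_le_c
  -- Otherwise `upDrift - c b_0` would be a negative real bound for `B_c'(1)`.
  have hdrift : ENNReal.ofReal (M.c * M.b 0) ≤ M.upDrift := by
    by_contra hcon
    rw [not_le] at hcon
    have hne : M.upDrift ≠ ∞ := hcon.ne_top
    have h1 : M.upDrift.toReal < M.c * M.b 0 := (ENNReal.lt_ofReal_iff_toReal_lt hne).1 hcon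
    refine h (lt_of_le_of_lt (M.derivBcOne_le_iff (L := M.upDrift.toReal - M.c * M.b 0) ?_ |>.2 ?_)
      (b := ((M.upDrift.toReal - M.c * M.b 0 : ℝ) : EReal)) ?_)
    · simp
    · simp [ENNReal.ofReal_toReal hne]
    · exact_mod_cast sub_neg.2 h1
  -- The kink is at `c - 1`: from `x ≥ c` the chain sees only the affine part at full service rate,
  -- and where `g` vanishes subharmonicity is free.
  set g : ℕ → ℝ≥0∞ := fun x => ((x - (M.c - 1) : ℕ) : ℝ≥0∞) with hg
  have hg0 : g (M.c - 1) = 0 := by simp [hg]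
  refine tsum_survival_eq_top_of_subharmonic (g := g) (fun x => ?_)
    (sub_le_tsum_survival M.jumpKernel_skipFree _)
    (M.tabooOp_pred_c_ne_zero hg0 fun y hy => ?_)
  · rw [tabooOp_eq_lintegral hg0]
    by_cases hx : x < M.c
    · have : x - (M.c - 1) = 0 := by omega
      rw [show g x = 0 by simp only [hg, this, Nat.cast_zero]]
      exact zero_le
    · obtain ⟨i, rfl⟩ : ∃ i, x = i + 1 := ⟨x - 1, by omega⟩
      have h1 := M.exitRate_succ_mul_lintegral_affine i g fun k => by
        simp only [hg]
        rw [show i + k - (M.c - 1) = (i - (M.c - 1)) + k by omega]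
        push_cast
        rfl
      rw [M.min_eq_c (not_lt.1 hx)] at h1
      refine (ENNReal.mul_le_mul_iff_right (M.ofReal_exitRate_ne_zero (i + 1))
        ENNReal.ofReal_ne_top).1 ?_
      refine (ENNReal.add_le_add_iff_right (a := ENNReal.ofReal (M.c * M.b 0))
        ENNReal.ofReal_ne_top).1 ?_
      rw [h1]
      gcongr
  · simp only [hg]
    exact_mod_cast (by omega : y - (M.c - 1) ≠ 0)

theorem tsum_survival_zero_eq_top (hμ : M.muOne = ∞) :
    ∑' n, survival M.qMatrix.jumpKernel 0 n 0 = ∞ := by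
  have hid : ∀ x : ℕ, (x : ℝ≥0∞) ≤ ∑' n, survival M.qMatrix.jumpKernel 0 n x := fun x => by
    simpa using sub_le_tsum_survival M.jumpKernel_skipFree 0 x
  have h1 : ∫⁻ y, (y : ℝ≥0∞) ∂(M.qMatrix.jumpKernel 0) = ∞ := by
    by_contra hne
    refine ENNReal.mul_ne_top (ENNReal.ofReal_ne_top (r := M.qMatrix.exitRate 0)) hne ?_
    rw [M.exitRate_zero_mul_lintegral fun x => (x : ℝ≥0∞), ← hμ, muOne]
    exact tsum_congr fun j => mul_comm _ _
  have h2 : ∫⁻ y, (y : ℝ≥0∞) ∂(M.qMatrix.jumpKernel 0)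
      ≤ ∑' n, survival M.qMatrix.jumpKernel 0 (n + 1) 0 := by
    rw [← tabooOp_eq_lintegral (j := 0) (f := fun y => (y : ℝ≥0∞)) (by simp)]
    refine (tabooOp_mono hid 0).trans_eq ?_
    rw [tabooOp_tsum]
    simp only [survival_succ]
  rw [h1, top_le_iff] at h2
  rw [tsum_eq_zero_add' ENNReal.summable, h2, add_top]

/-- Near `1` the slope is positive while `s - 1 < 0`, and `B_c(1) = 0`. -/
theorem exists_genBc_neg (h : ¬ M.derivBcOne ≤ 0) : ∃ s, 0 < s ∧ s < 1 ∧ M.genBc s < 0 := by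
  have h1 := M.tendsto_derivBcOne.eventually (lt_mem_nhds (not_le.1 h))
  obtain ⟨s, hs, hs'⟩ := (h1.and (Ioo_mem_nhdsLT (zero_lt_one' ℝ))).exists
  refine ⟨s, hs'.1, hs'.2, ?_⟩
  have h2 : 0 < (M.genBc s - M.genBc 1) / (s - 1) := by exact_mod_cast hs
  rw [genBc_one, sub_zero] at h2
  rcases div_pos_iff.1 h2 with h3 | h3
  · linarith [h3.2, hs'.2]
  · exact h3.1

/-- The functions `s ^ x` are superharmonic above the number of servers if `B_c(s) ≤ 0`. -/
theorem lintegral_pow_le {s : ℝ} (h0 : 0 < s) (h1 : s < 1) (hs : M.genBc s ≤ 0) {i : ℕ}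
    (hi : M.c ≤ i + 1) :
    ∫⁻ y, ENNReal.ofReal s ^ (y - (M.c - 1)) ∂(M.qMatrix.jumpKernel (i + 1))
      ≤ ENNReal.ofReal s ^ (i + 1 - (M.c - 1)) := by
  have hc := M.one_le_c
  obtain ⟨e, rfl⟩ : ∃ e, i = M.c - 1 + e := ⟨i - (M.c - 1), by omega⟩
  refine (ENNReal.mul_le_mul_iff_right (M.ofReal_exitRate_ne_zero (M.c - 1 + e + 1))
    ENNReal.ofReal_ne_top).1 ?_
  rw [M.exitRate_succ_mul_lintegral, M.min_eq_c hi]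
  have e1 : M.c - 1 + e - (M.c - 1) = e := by omega
  have e2 : ∀ k, M.c - 1 + e + 2 + k - (M.c - 1) = e + (k + 2) := fun k => by omega
  have e3 : M.c - 1 + e + 1 - (M.c - 1) = e + 1 := by omega
  have hsum : HasSum (fun k => M.b (k + 2) * s ^ (k + 2)) (M.genB s - (M.b 0 + M.b 1 * s)) := by
    have := (hasSum_nat_add_iff' 2).2 (M.summable_b_mul_pow h0.le h1.le).hasSum
    simpa [Finset.sum_range_succ, genB] using this
  have hnn : ∀ k, 0 ≤ M.b (k + 2) * s ^ (k + 2) := fun k =>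
    mul_nonneg (M.b_add_two_nonneg k) (pow_nonneg h0.le _)
  have h2 : ∑' k, ENNReal.ofReal (M.b (k + 2)) * ENNReal.ofReal s ^ (e + (k + 2))
      = ENNReal.ofReal s ^ e * ENNReal.ofReal (M.genB s - (M.b 0 + M.b 1 * s)) := by
    rw [← hsum.tsum_eq, ENNReal.ofReal_tsum_of_nonneg hnn hsum.summable, ← ENNReal.tsum_mul_left]
    refine tsum_congr fun k => ?_
    rw [ENNReal.ofReal_mul (M.b_add_two_nonneg k), ENNReal.ofReal_pow h0.le, pow_add]
    ring
  simp only [e1, e2, e3]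
  rw [h2, mul_comm (ENNReal.ofReal (M.c * M.b 0)), ← mul_add, pow_succ, mul_left_comm]
  gcongr
  have hcb : 0 ≤ M.c * M.b 0 := by
    have := M.b_zero_pos
    positivity
  rw [← ENNReal.ofReal_add hcb (hsum.nonneg hnn), ← ENNReal.ofReal_mul (M.exitRate_pos _).le]
  refine ENNReal.ofReal_le_ofReal ?_
  -- With the power `s ^ e` cancelled, the remaining inequality is exactly `B_c(s) ≤ 0`.
  rw [exitRate_succ, M.min_eq_c hi]
  unfold genBc at hs
  linarith

theorem iInf_survival_ne_zero (h : ¬ M.derivBcOne ≤ 0) :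
    ⨅ n, survival M.qMatrix.jumpKernel (M.c - 1) n (M.c - 1) ≠ 0 := by
  have hc := M.one_le_c
  obtain ⟨s, h0, h1, hs⟩ := M.exists_genBc_neg h
  have hσ : ENNReal.ofReal s < 1 := by simpa using h1
  set f : ℕ → ℝ≥0∞ := fun x => ENNReal.ofReal s ^ (x - (M.c - 1)) with hf
  have hf1 : ∀ x, f x ≤ 1 := fun x => pow_le_one₀ zero_le hσ.le
  -- Bounded, subharmonic, zero up to `c - 1` and positive above, where an upward jump from `c - 1`
  -- lands.
  set g : ℕ → ℝ≥0∞ := fun x => 1 - f x with hg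
  have hg0 : g (M.c - 1) = 0 := by simp [hg, hf]
  have hsub : g ≤ tabooOp M.qMatrix.jumpKernel (M.c - 1) g := fun x => by
    rw [tabooOp_eq_lintegral hg0]
    by_cases hx : x < M.c
    · have : x - (M.c - 1) = 0 := by omega
      simp [hg, hf, this]
    · obtain ⟨i, rfl⟩ : ∃ i, x = i + 1 := ⟨x - 1, by omega⟩
      have h2 : ∫⁻ y, f y ∂(M.qMatrix.jumpKernel (i + 1)) ≤ f (i + 1) :=
        M.lintegral_pow_le h0 h1 hs.le (not_lt.1 hx)
      have h3 : ∫⁻ y, g y ∂(M.qMatrix.jumpKernel (i + 1))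
          + ∫⁻ y, f y ∂(M.qMatrix.jumpKernel (i + 1)) = 1 := by
        rw [← lintegral_add_left Measurable.of_discrete]
        simp [hg, tsub_add_cancel_of_le (hf1 _)]
      refine tsub_le_iff_right.2 ?_
      rw [← h3]
      gcongr
  refine fun hzero => M.tabooOp_pred_c_ne_zero hg0 (fun y hy => ?_)
    (nonpos_iff_eq_zero.1 (hzero ▸ tabooOp_le_iInf_survival (fun x => tsub_le_self) hsub (M.c - 1)))
  refine (tsub_pos_of_lt ?_).ne'
  exact pow_lt_one₀ zero_le hσ (by omega)

end BulkQueue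

/-- The `M^X/M/c` queue with resurrection is recurrent iff `B_c'(1) ≤ 0`, and it is positive
recurrent iff `B_c'(1) < 0` and `μ_1 < ∞`. -/
theorem theorem3p2 (M : BulkQueue) :
    (M.qMatrix.IsRecurrent ↔ M.derivBcOne ≤ 0) ∧
      (M.qMatrix.IsPositiveRecurrent ↔ M.derivBcOne < 0 ∧ M.muOne < ∞) := by
  rw [ConservativeQMatrix.isRecurrent_iff M.exitRate_pos,
    ConservativeQMatrix.isPositiveRecurrent_iff M.exitRate_pos M.min_rate_pos M.le_exitRate
      M.exitRate_le]
  refine ⟨⟨fun h => ?_, M.iInf_survival_eq_zero_of_derivBcOne_nonpos⟩, fun h => ⟨?_, ?_⟩,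
    fun h => M.tsum_survival_ne_top_of_derivBcOne_neg h.1 h.2⟩
  · by_contra hcon
    exact M.iInf_survival_ne_zero hcon (h _)
  · by_contra hcon
    exact h _ (M.tsum_survival_eq_top hcon)
  · by_contra hcon
    exact h _ (M.tsum_survival_zero_eq_top (not_lt_top_iff.1 hcon))
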